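/- Let $M$ be a smooth manifold (finite-dimensional, Hausdorff, second countable), let $\pi,\pi'$ be Poisson structures on $M$, and let $\star$ and $\star'$ be star products on $(M,\pi)$ and $(M,\pi')$, respectively. That is, $f\star g=\sum_{r\ge 0}\lambda^r C_r(f,g)$ is an associative $\mathbb{C}[[\lambda]]$-bilinear product on $C^\infty(M)[[\lambda]]$ (complex-valued functions) with bidifferential operators $C_r$ such that $C_0(f,g)=fg$, $C_1(f,g)-C_1(g,f)=\mathrm{i}\{f,g\}_\pi$ and $1\star f=f=f\star 1$; similarly for $\star'$ with $\pi'$. Let $\mathcal{E}$ be a $C^\infty(M)$-module (for instance the sections of a complex line bundle), regarded as a bimodule with equal left and right actions, and suppose that $\mathcal{E}[[\lambda]]$ carries a deformed bimodule structure: $\mathbb{C}[[\lambda]]$-bilinear, unital, commuting actions, of $(C^\infty(M)[[\lambda]],\star')$ from the left and of $(C^\infty(M)[[\lambda]],\star)$ from the right, which in zeroth order in $\lambda$ are the given actions on $\mathcal{E}$. Suppose that this deformed bimodule is a Morita equivalence bimodule in at least one of the following senses: (a) (ring-theoretically) as a right $\star$-module it is finitely generated, projective and a generator, and the left action is an isomorphism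 of $(C^\infty(M)[[\lambda]],\star')$ onto its ring of right $\star$-linear endomorphisms; or (b) (with involutions) both star products are Hermitian, i.e. $\overline{f\star g}=\bar g\star\bar f$ and likewise for $\star'$ (with $\bar\lambda=\lambda$), and there are full Hermitian inner products $\langle\cdot,\cdot\rangle$ and $\Theta_{\cdot,\cdot}$ on the bimodule, right $\star$-linear in the second argument with values in $(C^\infty(M)[[\lambda]],\star)$ and left $\star'$-linear in the first argument with values in $(C^\infty(M)[[\lambda]],\star')$, respectively, which are compatible with the actions ($\langle b\cdot x,y\rangle=\langle x,\bar b\cdot y\rangle$, $\Theta_{x,y\cdot a}=\Theta_{x\cdot\bar a,y}$) and with each other ($\Theta_{x,y}\cdot z=x\cdot\langle y,z\rangle$). Full means that the values span the respective algebra. In particular this holds for strong Morita equivalence bimodules, whose inner products are in addition positive. Then $\star$ and $\star'$ are locally equivalent: every point of $M$ has an open neighbourhood $U$ such that the restrictions of $\star$ and $\star'$ to $U$ are equivalent, i.e. there is a formal series $T=\mathrm{id}+\sum_{r\ge1}\lambda^rT_r$ of differential operators on $C^\infty(U)$ with $T(f\star' g)=Tf\star Tg$ for all $f,g\in C^\infty(U)[[\lambda]]$.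 In particular $\{f,g\}_\pi=\{f,g\}_{\pi'}$ for all $f,g\in C^\infty(M)$. -/

import Mathlib

open scoped Manifold ContDiff
open TopologicalSpace

namespace DeformationQuantization

/-! ### Complex-valued smooth functions -/

/-- The complex-valued smooth functions on an `n`-dimensional real manifold `M`. -/
abbrev SmoothFun (n : ℕ) (M : Type*) [TopologicalSpace M]
    [ChartedSpace (EuclideanSpace ℝ (Fin n)) M] : Type _ :=
  C^∞⟮𝓡 n, M; 𝓘(ℝ, ℂ), ℂ⟯

/-- Addition and multiplication of complex numbers are smooth over the reals. -/
instance instContMDiffRingComplex : ContMDiffRing 𝓘(ℝ, ℂ) ∞ ℂ where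
  contMDiff_add := by
    rw [contMDiff_iff]
    refine ⟨continuous_add, fun x y => ?_⟩
    simp only [mfld_simps, chartAt_self_eq]
    rw [contDiffOn_univ]
    exact contDiff_add
  contMDiff_mul := by
    rw [contMDiff_iff]
    refine ⟨continuous_mul, fun x y => ?_⟩
    simp only [mfld_simps, chartAt_self_eq]
    rw [contDiffOn_univ]
    exact contDiff_mul

section SmoothFunctions

variable {n : ℕ} {M : Type*} [TopologicalSpace M] [ChartedSpace (EuclideanSpace ℝ (Fin n)) M]

/-- The complex algebra structure on smooth functions; scalars act as constant functions. -/
noncomputable instance SmoothFun.instAlgebraComplex : Algebra ℂ (SmoothFun n M) :=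
  RingHom.toAlgebra
    { toFun := fun c => ContMDiffMap.const c
      map_one' := rfl
      map_zero' := rfl
      map_mul' := fun _ _ => rfl
      map_add' := fun _ _ => rfl }

/-- Pointwise complex conjugation of a smooth function. -/
noncomputable def SmoothFun.conj (f : SmoothFun n M) : SmoothFun n M :=
  ⟨fun x => starRingEnd ℂ (f x), Complex.conjCLE.contDiff.contMDiff.comp f.contMDiff⟩

/-- Restriction of a smooth function to an open subset, which is itself a manifold. -/
noncomputable def SmoothFun.restrict (U : Opens M) (f : SmoothFun n M) : SmoothFun n U :=
  ⟨fun x => f x, f.contMDiff.comp contMDiff_subtype_val⟩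

/-! ### Differential operators -/

/-- The commutator `f ↦ D (a f) - a D f` of `D` with the multiplication by `a`. -/
noncomputable def mulCommutator (D : SmoothFun n M →ₗ[ℂ] SmoothFun n M) (a : SmoothFun n M) :
    SmoothFun n M →ₗ[ℂ] SmoothFun n M :=
  D ∘ₗ LinearMap.mulLeft ℂ a - LinearMap.mulLeft ℂ a ∘ₗ D

/-- `D` is on `V` a differential operator of order at most `k`: all `(k + 1)`-fold iterated
commutators of `D` with multiplications by smooth functions vanish on `V`. -/
def HasOrderLEOn (V : Set M) : ℕ → (SmoothFun n M →ₗ[ℂ] SmoothFun n M) → Prop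
  | 0, D => ∀ a f, ∀ x ∈ V, mulCommutator D a f x = 0
  | k + 1, D => ∀ a, HasOrderLEOn V k (mulCommutator D a)

/-- Linear differential operators on smooth functions: around every point the order is finite
(on a non-compact manifold it need not be globally bounded). -/
def IsDifferentialOperator (D : SmoothFun n M →ₗ[ℂ] SmoothFun n M) : Prop :=
  ∀ p : M, ∃ V : Set M, IsOpen V ∧ p ∈ V ∧ ∃ k, HasOrderLEOn V k D

/-- Bidifferential operators: differential operators in each argument, of an order which around
every point is bounded independently of the other argument. -/
def IsBidifferentialOperator (C : SmoothFun n M →ₗ[ℂ] SmoothFun n M →ₗ[ℂ] SmoothFun n M) :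
    Prop :=
  ∀ p : M, ∃ V : Set M, IsOpen V ∧ p ∈ V ∧ ∃ k,
    (∀ f, HasOrderLEOn V k (C f)) ∧ ∀ g, HasOrderLEOn V k (C.flip g)

end SmoothFunctions

/-! ### Formal power series

Formal power series `∑ λ ^ r v r` with coefficients in `V` are represented by their sequence of
coefficients `v : ℕ → V`. -/

section FormalSeries

variable {U V W : Type*} [AddCommGroup U] [Module ℂ U] [AddCommGroup V] [Module ℂ V]
  [AddCommGroup W] [Module ℂ W]

/-- The constant formal power series with value `v`. -/
def constSeries (v : V) : ℕ → V := Pi.single 0 v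

/-- The map of formal power series given by a formal power series `∑ λ ^ r T r` of linear maps. -/
def formalApply (T : ℕ → V →ₗ[ℂ] W) (v : ℕ → V) : ℕ → W :=
  fun m => ∑ p ∈ Finset.HasAntidiagonal.antidiagonal m, T p.1 (v p.2)

/-- The bilinear map of formal power series given by a formal power series `∑ λ ^ r C r` of
bilinear maps: the coefficient at `m` is the sum of all `C r (u i) (v j)` with `r + (i + j) = m`. -/
def formalMul (C : ℕ → U →ₗ[ℂ] V →ₗ[ℂ] W) (u : ℕ → U) (v : ℕ → V) : ℕ → W :=
  fun m => ∑ p ∈ Finset.HasAntidiagonal.antidiagonal m, ∑ q ∈ Finset.HasAntidiagonal.antidiagonal p.2, C p.1 (u q.1) (v q.2)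

theorem formalMul_add_left (C : ℕ → U →ₗ[ℂ] V →ₗ[ℂ] W) (u u' : ℕ → U) (v : ℕ → V) :
    formalMul C (u + u') v = formalMul C u v + formalMul C u' v := by
  funext m
  simp [formalMul, Finset.sum_add_distrib]

theorem formalMul_add_right (C : ℕ → U →ₗ[ℂ] V →ₗ[ℂ] W) (u : ℕ → U) (v v' : ℕ → V) :
    formalMul C u (v + v') = formalMul C u v + formalMul C u v' := by
  funext m
  simp [formalMul, Finset.sum_add_distrib]

theorem formalMul_zero_left (C : ℕ → U →ₗ[ℂ] V →ₗ[ℂ] W) (v : ℕ → V) :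
    formalMul C 0 v = 0 := by
  funext m
  simp [formalMul]

theorem formalMul_zero_right (C : ℕ → U →ₗ[ℂ] V →ₗ[ℂ] W) (u : ℕ → U) :
    formalMul C u 0 = 0 := by
  funext m
  simp [formalMul]

end FormalSeries

/-! ### Poisson structures and star products -/

/-- A (real) Poisson structure on `M`, given by its Poisson bracket, extended complex-bilinearly
to complex-valued functions. -/
structure PoissonStructure (n : ℕ) (M : Type*) [TopologicalSpace M]
    [ChartedSpace (EuclideanSpace ℝ (Fin n)) M] where
  bracket : SmoothFun n M →ₗ[ℂ] SmoothFun n M →ₗ[ℂ] SmoothFun n M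
  antisymm : ∀ f g, bracket f g = -bracket g f
  jacobi : ∀ f g h,
    bracket f (bracket g h) + bracket g (bracket h f) + bracket h (bracket f g) = 0
  leibniz : ∀ f g h, bracket f (g * h) = bracket f g * h + g * bracket f h
  real : ∀ f g, (bracket f g).conj = bracket f.conj g.conj

/-- A star product `f ⋆ g = ∑ λ ^ r C r (f, g)` on the Poisson manifold `(M, P)`. -/
structure StarProduct {n : ℕ} {M : Type*} [TopologicalSpace M]
    [ChartedSpace (EuclideanSpace ℝ (Fin n)) M] (P : PoissonStructure n M) where
  C : ℕ → SmoothFun n M →ₗ[ℂ] SmoothFun n M →ₗ[ℂ] SmoothFun n M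
  bidifferential : ∀ r, IsBidifferentialOperator (C r)
  assoc : ∀ f g h : ℕ → SmoothFun n M,
    formalMul C (formalMul C f g) h = formalMul C f (formalMul C g h)
  C_zero : ∀ f g, C 0 f g = f * g
  C_one : ∀ f g, C 1 f g - C 1 g f = Complex.I • P.bracket f g
  one_star : ∀ f : ℕ → SmoothFun n M, formalMul C (constSeries 1) f = f
  star_one : ∀ f : ℕ → SmoothFun n M, formalMul C f (constSeries 1) = f

section StarProducts

variable {n : ℕ} {M : Type*} [TopologicalSpace M] [ChartedSpace (EuclideanSpace ℝ (Fin n)) M]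

/-- Equivalence of star products: there is a formal series `T = id + ∑ λ ^ r T r` of differential
operators with `T (f ⋆' g) = T f ⋆ T g`. -/
def StarProduct.Equivalent {P P' : PoissonStructure n M} (s : StarProduct P)
    (s' : StarProduct P') : Prop :=
  ∃ T : ℕ → SmoothFun n M →ₗ[ℂ] SmoothFun n M,
    T 0 = LinearMap.id ∧ (∀ r, IsDifferentialOperator (T r)) ∧
    ∀ f g : ℕ → SmoothFun n M,
      formalApply T (formalMul s'.C f g) = formalMul s.C (formalApply T f) (formalApply T g)

/-- The star product `sU` on the open subset `U` is the restriction of `s`. As the operators are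
bidifferential there is exactly one restriction. -/
def StarProduct.IsRestriction {P : PoissonStructure n M} (s : StarProduct P) {U : Opens M}
    {PU : PoissonStructure n U} (sU : StarProduct PU) : Prop :=
  ∀ r (f g : SmoothFun n M), sU.C r (f.restrict U) (g.restrict U) = (s.C r f g).restrict U

/-- Local equivalence of star products: the open subsets on which the restrictions exist and are
equivalent cover the manifold. -/
def StarProduct.LocallyEquivalent {P P' : PoissonStructure n M} (s : StarProduct P)
    (s' : StarProduct P') : Prop :=
  ∀ p : M, ∃ U : Opens M, p ∈ U ∧
    ∃ (PU PU' : PoissonStructure n U) (sU : StarProduct PU) (sU' : StarProduct PU'),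
      s.IsRestriction sU ∧ s'.IsRestriction sU' ∧ sU.Equivalent sU'

/-- The deformed algebra: formal power series of smooth functions with the product `⋆`. -/
def StarProduct.Alg {P : PoissonStructure n M} (_s : StarProduct P) : Type _ :=
  ℕ → SmoothFun n M

noncomputable instance StarProduct.instAddCommGroupAlg {P : PoissonStructure n M}
    (s : StarProduct P) : AddCommGroup s.Alg :=
  inferInstanceAs (AddCommGroup (ℕ → SmoothFun n M))

noncomputable instance StarProduct.instRingAlg {P : PoissonStructure n M} (s : StarProduct P) :
    Ring s.Alg :=
  { (inferInstance : AddCommGroup s.Alg) with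
    mul := fun f g => formalMul s.C f g
    one := (constSeries 1 : ℕ → SmoothFun n M)
    mul_assoc := s.assoc
    one_mul := s.one_star
    mul_one := s.star_one
    left_distrib := fun f g h => formalMul_add_right s.C f g h
    right_distrib := fun f g h => formalMul_add_left s.C f g h
    zero_mul := fun f => formalMul_zero_left s.C f
    mul_zero := fun f => formalMul_zero_right s.C f }

/-- The involution on the deformed algebra: complex conjugation of all coefficients, with the
formal parameter being real. -/
noncomputable def StarProduct.conj {P : PoissonStructure n M} (s : StarProduct P) (f : s.Alg) :
    s.Alg :=
  fun r => SmoothFun.conj (f r)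

/-- Hermitian star products. -/
def StarProduct.IsHermitian {P : PoissonStructure n M} (s : StarProduct P) : Prop :=
  ∀ f g : s.Alg, s.conj (f * g) = s.conj g * s.conj f

end StarProducts

/-! ### Deformed bimodules and Morita equivalence -/

/-- A deformation, into a bimodule over the deformed algebras of `s'` (from the left) and of `s`
(from the right), of the module `E` over the smooth functions, the latter being viewed as bimodule
with equal left and right actions. The deformed actions are
`f •' x = ∑ λ ^ r L r (f, x)` and `x • f = ∑ λ ^ r R r (x, f)` on formal power series with
coefficients in `E`. -/
structure DeformedBimodule {n : ℕ} {M : Type*} [TopologicalSpace M]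
    [ChartedSpace (EuclideanSpace ℝ (Fin n)) M] {P' P : PoissonStructure n M}
    (s' : StarProduct P') (s : StarProduct P) (E : Type*) [AddCommGroup E] [Module ℂ E]
    [Module (SmoothFun n M) E] where
  L : ℕ → SmoothFun n M →ₗ[ℂ] E →ₗ[ℂ] E
  R : ℕ → E →ₗ[ℂ] SmoothFun n M →ₗ[ℂ] E
  L_zero : ∀ f x, L 0 f x = f • x
  R_zero : ∀ x f, R 0 x f = f • x
  one_left : ∀ x : ℕ → E, formalMul L (constSeries 1) x = x
  right_one : ∀ x : ℕ → E, formalMul R x (constSeries 1) = x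
  left_assoc : ∀ (f g : ℕ → SmoothFun n M) (x : ℕ → E),
    formalMul L (formalMul s'.C f g) x = formalMul L f (formalMul L g x)
  right_assoc : ∀ (x : ℕ → E) (f g : ℕ → SmoothFun n M),
    formalMul R x (formalMul s.C f g) = formalMul R (formalMul R x f) g
  left_right : ∀ (f : ℕ → SmoothFun n M) (x : ℕ → E) (g : ℕ → SmoothFun n M),
    formalMul R (formalMul L f x) g = formalMul L f (formalMul R x g)

namespace DeformedBimodule

variable {n : ℕ} {M : Type*} [TopologicalSpace M] [ChartedSpace (EuclideanSpace ℝ (Fin n)) M]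
  {P' P : PoissonStructure n M} {s' : StarProduct P'} {s : StarProduct P}
  {E : Type*} [AddCommGroup E] [Module ℂ E] [Module (SmoothFun n M) E]

/-- The underlying additive group of a deformed bimodule: formal power series in `E`. -/
def Carrier (_B : DeformedBimodule s' s E) : Type _ := ℕ → E

noncomputable instance instAddCommGroupCarrier (B : DeformedBimodule s' s E) :
    AddCommGroup B.Carrier :=
  inferInstanceAs (AddCommGroup (ℕ → E))

noncomputable instance instLeftModule (B : DeformedBimodule s' s E) :
    Module s'.Alg B.Carrier where
  smul f x := formalMul B.L f x
  one_smul := B.one_left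
  mul_smul := B.left_assoc
  smul_zero f := formalMul_zero_right B.L f
  smul_add f x y := formalMul_add_right B.L f x y
  add_smul f g x := formalMul_add_left B.L f g x
  zero_smul x := formalMul_zero_left B.L x

/-- The right module structure, as usual written as a module structure over the opposite ring. -/
noncomputable instance instRightModule (B : DeformedBimodule s' s E) :
    Module (s.Alg)ᵐᵒᵖ B.Carrier where
  smul f x := formalMul B.R x f.unop
  one_smul := B.right_one
  mul_smul f g x := B.right_assoc x g.unop f.unop
  smul_zero f := formalMul_zero_left B.R f.unop
  smul_add f x y := formalMul_add_left B.R x y f.unop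
  add_smul f g x := formalMul_add_right B.R x f.unop g.unop
  zero_smul x := formalMul_zero_right B.R x

instance instSMulCommClass (B : DeformedBimodule s' s E) :
    SMulCommClass s'.Alg (s.Alg)ᵐᵒᵖ B.Carrier where
  smul_comm f g x := (B.left_right f x g.unop).symm

/-- The deformed bimodule is an equivalence bimodule in the sense of ring-theoretic Morita theory:
as a right module it is finitely generated, projective and a generator, and the left action
identifies the algebra acting from the left with the right linear endomorphisms. -/
structure IsEquivalenceBimodule (B : DeformedBimodule s' s E) : Prop where
  finite : Module.Finite (s.Alg)ᵐᵒᵖ B.Carrier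
  projective : Module.Projective (s.Alg)ᵐᵒᵖ B.Carrier
  generator : ∃ (m : ℕ) (φ : (Fin m → B.Carrier) →ₗ[(s.Alg)ᵐᵒᵖ] s.Alg), Function.Surjective φ
  endomorphisms :
    Function.Bijective (Module.toModuleEnd (s.Alg)ᵐᵒᵖ (S := s'.Alg) B.Carrier)

/-- The deformed bimodule is an equivalence bimodule for the deformed algebras as algebras with
involution: both star products are Hermitian and there are compatible full Hermitian inner products
with values in the two algebras. (For strong Morita equivalence the inner products have moreover to
be positive.) Linearity over the algebras implies linearity over the formal power series of complex
numbers, which act as constant functions; for the same reason the additive span of the values of an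
inner product is its linear span. -/
def IsStarEquivalenceBimodule (B : DeformedBimodule s' s E) : Prop :=
  s.IsHermitian ∧ s'.IsHermitian ∧
  ∃ (h : B.Carrier → B.Carrier →ₗ[(s.Alg)ᵐᵒᵖ] s.Alg) (Θ : B.Carrier → B.Carrier → s'.Alg),
    (∀ x y, h x y = s.conj (h y x)) ∧
    (∀ (b : s'.Alg) x y, h (b • x) y = h x (s'.conj b • y)) ∧
    (∀ x y z, Θ (x + y) z = Θ x z + Θ y z) ∧
    (∀ (b : s'.Alg) x y, Θ (b • x) y = b * Θ x y) ∧
    (∀ x y, Θ x y = s'.conj (Θ y x)) ∧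
    (∀ (a : s.Alg) x y, Θ x (MulOpposite.op a • y) = Θ (MulOpposite.op (s.conj a) • x) y) ∧
    (∀ x y z, Θ x y • z = MulOpposite.op (h y z) • x) ∧
    AddSubgroup.closure {a | ∃ x y, h x y = a} = ⊤ ∧
    AddSubgroup.closure {b | ∃ x y, Θ x y = b} = ⊤

end DeformedBimodule

end DeformationQuantization

/-! A Morita bimodule supplies, near any point p, a right linear functional φ and an element e with
φ(e) = 1, such that every endomorphism z ↦ e'·φ(z) is the left action of some element of the left
algebra (`exists_rankOne_eq_smul`). Both notions of equivalence enter only through this fact: in (a)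
the bimodule is a generator and the left action is onto the endomorphisms, in (b) φ = ⟨y, ·⟩ and the
element is Θ_{e',y}.

The equivalence is T(a) = φ(a·e). If b acts as z ↦ e·φ(z), then a·b·a'·e = (a·e)·φ(a'·e), and hence
T(a ⋆' b ⋆' a') = T(a) ⋆ T(a'). Right linearity makes T linear over ℂ[[λ]], so T is a series ∑ λ^r
T_r; since left and right actions agree modulo λ, T_0 is multiplication by φ(e)_0, the identity near
p (`exists_coefficient`).

Nothing so far makes T_r local. This follows from the product formula: if f vanishes on V and χ is a
bump function supported in V, then f ⋆' b ⋆' χ = 0, so T(f) ⋆ T(χ) = 0, and T(χ), invertible in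
order zero where χ = 1, can be cancelled (`isLocalOn_of_middle_mul`). A local series starting with
the identity is injective on germs, so T(b) = T(1) ⋆ T(1) = 1 = T(1) forces b = 1 near p and T is
multiplicative there. The coefficient of λ^N in T(f ⋆' g) = T(f) ⋆ T(g) expresses the commutator of
T_N with g through T_r, r < N, and the bidifferential C_r, C'_r; by induction T_N is a differential
operator (`exists_hasOrderLTOn_of_agreeOn`). The coefficient of λ, antisymmetrised, compares the
brackets. -/

namespace DeformationQuantization

/-! ### Bump functions, extension of germs and local inverses -/

section Bump

variable {n : ℕ} {M : Type*} [TopologicalSpace M] [ChartedSpace (EuclideanSpace ℝ (Fin n)) M]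

theorem SmoothFun.add_apply (f g : SmoothFun n M) (x : M) : (f + g) x = f x + g x := rfl

theorem SmoothFun.sub_apply (f g : SmoothFun n M) (x : M) : (f - g) x = f x - g x := rfl

theorem SmoothFun.mul_apply (f g : SmoothFun n M) (x : M) : (f * g) x = f x * g x := rfl

theorem SmoothFun.neg_apply (f : SmoothFun n M) (x : M) : (-f) x = -f x := rfl

theorem SmoothFun.one_apply (x : M) : (1 : SmoothFun n M) x = 1 := rfl

theorem SmoothFun.smul_apply (c : ℂ) (f : SmoothFun n M) (x : M) : (c • f) x = c * f x := by
  rw [Algebra.smul_def]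
  rfl

theorem SmoothFun.conj_apply (f : SmoothFun n M) (x : M) :
    f.conj x = starRingEnd ℂ (f x) := rfl

/-- Evaluation of smooth functions at a point, as a linear map. -/
noncomputable def SmoothFun.evalAt (x : M) : SmoothFun n M →ₗ[ℂ] ℂ where
  toFun f := f x
  map_add' _ _ := rfl
  map_smul' c f := SmoothFun.smul_apply c f x

theorem SmoothFun.sum_apply {ι : Type*} (t : Finset ι) (f : ι → SmoothFun n M) (x : M) :
    (∑ i ∈ t, f i) x = ∑ i ∈ t, f i x :=
  map_sum (SmoothFun.evalAt x) f t

theorem SmoothFun.exists_bump [IsManifold (𝓡 n) ∞ M] [T2Space M] {U : Set M} (hU : IsOpen U)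
    {q : M} (hq : q ∈ U) : ∃ χ : SmoothFun n M, ∃ W : Set M, IsOpen W ∧ q ∈ W ∧ W ⊆ U ∧
      (∀ x ∈ W, χ x = 1) ∧ closure (Function.support χ) ⊆ U := by
  obtain ⟨f, -, hf⟩ :=
    (SmoothBumpFunction.nhds_basis_tsupport (I := 𝓡 n) q).mem_iff.1 (hU.mem_nhds hq)
  obtain ⟨W, hW, hWo, hqW⟩ := eventually_nhds_iff.1 f.eventuallyEq_one
  have hs : ContMDiff (𝓡 n) 𝓘(ℝ, ℂ) ∞ (fun x => (f x : ℂ)) :=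
    Complex.ofRealCLM.contDiff.contMDiff.comp f.contMDiff
  refine ⟨⟨fun x => (f x : ℂ), hs⟩, W ∩ U, hWo.inter hU, ⟨hqW, hq⟩, Set.inter_subset_right,
    fun x hx => ?_, ?_⟩
  · have := hW x hx.1
    change ((f x : ℝ) : ℂ) = 1
    rw [this]
    simp
  · refine (closure_mono fun x hx => ?_).trans hf
    simp only [Function.mem_support] at hx ⊢
    exact fun h => hx (by change ((f x : ℝ) : ℂ) = 0; rw [h]; simp)

open Classical in
-- At a point outside `U` the function vanishes on a whole neighbourhood, because the closed support
-- of `χ` stays inside `U`.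
theorem SmoothFun.contMDiff_extend (U : Opens M) (χ : SmoothFun n M)
    (hχ : closure (Function.support χ) ⊆ U) (f : SmoothFun n U) :
    ContMDiff (𝓡 n) 𝓘(ℝ, ℂ) ∞ (fun x : M => if h : x ∈ U then χ x * f ⟨x, h⟩ else 0) := by
  intro x
  by_cases hx : x ∈ U
  · have h2 : ContMDiffAt (𝓡 n) 𝓘(ℝ, ℂ) ∞ (χ.restrict U * f : SmoothFun n U) ⟨x, hx⟩ :=
      (χ.restrict U * f : SmoothFun n U).contMDiff.contMDiffAt
    refine (contMDiffAt_subtype_iff (x := (⟨x, hx⟩ : U))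
      (f := fun x => if h : x ∈ U then χ x * f ⟨x, h⟩ else 0)).1
      (h2.congr_of_eventuallyEq (Filter.Eventually.of_forall fun y => ?_))
    simp only [y.2, dite_true]
    rfl
  · have h0 : (fun x : M => if h : x ∈ U then χ x * f ⟨x, h⟩ else 0) =ᶠ[nhds x]
        fun _ => (0 : ℂ) := by
      filter_upwards [isClosed_closure.isOpen_compl.mem_nhds (fun h => hx (hχ h))] with y hy
      split_ifs
      · rw [Function.notMem_support.1 fun h => hy (subset_closure h), zero_mul]
      · rfl
    exact contMDiffAt_const.congr_of_eventuallyEq h0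

open Classical in
/-- Extension by zero of the product of `f`, given on an open subset `U`, with a function
supported in `U`. -/
noncomputable def SmoothFun.extendFun (U : Opens M) (χ : SmoothFun n M)
    (hχ : closure (Function.support χ) ⊆ U) (f : SmoothFun n U) : SmoothFun n M :=
  ⟨fun x => if h : x ∈ U then χ x * f ⟨x, h⟩ else 0, SmoothFun.contMDiff_extend U χ hχ f⟩

theorem SmoothFun.extendFun_of_mem (U : Opens M) (χ : SmoothFun n M)
    (hχ : closure (Function.support χ) ⊆ U) (f : SmoothFun n U) {x : M} (hx : x ∈ U) :
    SmoothFun.extendFun U χ hχ f x = χ x * f ⟨x, hx⟩ :=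
  dif_pos hx

theorem SmoothFun.extendFun_of_notMem (U : Opens M) (χ : SmoothFun n M)
    (hχ : closure (Function.support χ) ⊆ U) (f : SmoothFun n U) {x : M} (hx : x ∉ U) :
    SmoothFun.extendFun U χ hχ f x = 0 :=
  dif_neg hx

/-- Extension by zero after multiplication with a function supported in `U`, as a linear map. -/
noncomputable def SmoothFun.extend (U : Opens M) (χ : SmoothFun n M)
    (hχ : closure (Function.support χ) ⊆ U) : SmoothFun n U →ₗ[ℂ] SmoothFun n M where
  toFun := SmoothFun.extendFun U χ hχ
  map_add' f g := by
    refine ContMDiffMap.ext fun x => ?_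
    rw [SmoothFun.add_apply]
    by_cases h : x ∈ U
    · simp only [SmoothFun.extendFun_of_mem U χ hχ _ h, SmoothFun.add_apply, mul_add]
    · simp only [SmoothFun.extendFun_of_notMem U χ hχ _ h, add_zero]
  map_smul' c f := by
    refine ContMDiffMap.ext fun x => ?_
    rw [RingHom.id_apply, SmoothFun.smul_apply]
    by_cases h : x ∈ U
    · simp only [SmoothFun.extendFun_of_mem U χ hχ _ h, SmoothFun.smul_apply, mul_left_comm]
    · simp only [SmoothFun.extendFun_of_notMem U χ hχ _ h, mul_zero]

theorem SmoothFun.extend_apply (U : Opens M) (χ : SmoothFun n M)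
    (hχ : closure (Function.support χ) ⊆ U) (f : SmoothFun n U) (x : U) :
    SmoothFun.extend U χ hχ f x = χ x * f x :=
  SmoothFun.extendFun_of_mem U χ hχ f x.2

/-- Around every point there is a simultaneous linear extension of the germs of the smooth
functions on an open subset. -/
theorem SmoothFun.exists_extension [IsManifold (𝓡 n) ∞ M] [T2Space M] (U : Opens M) (q : U) :
    ∃ F : SmoothFun n U →ₗ[ℂ] SmoothFun n M, ∃ W : Set M, IsOpen W ∧ (q : M) ∈ W ∧ W ⊆ U ∧
      ∀ f, ∀ x : U, (x : M) ∈ W → F f x = f x := by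
  obtain ⟨χ, W, hWo, hqW, hWU, h1, hχ⟩ := SmoothFun.exists_bump (n := n) U.2 q.2
  refine ⟨SmoothFun.extend U χ hχ, W, hWo, hqW, hWU, fun f x hx => ?_⟩
  rw [SmoothFun.extend_apply, h1 x hx, one_mul]

theorem SmoothFun.exists_local_inverse [IsManifold (𝓡 n) ∞ M] [T2Space M] (g : SmoothFun n M)
    {p : M} (hp : g p ≠ 0) : ∃ h : SmoothFun n M, ∃ W : Set M, IsOpen W ∧ p ∈ W ∧
      ∀ x ∈ W, g x * h x = 1 := by
  have hU : IsOpen {x | g x ≠ 0} := isOpen_ne_fun g.contMDiff.continuous continuous_const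
  let U : Opens M := ⟨_, hU⟩
  let k : SmoothFun n U := ⟨fun x => (g x)⁻¹, fun x =>
    ((contDiffAt_inv ℝ x.2).contMDiffAt.comp x ((g.restrict U).contMDiff x) :)⟩
  obtain ⟨F, W, hWo, hqW, hWU, hF⟩ := SmoothFun.exists_extension (n := n) U ⟨p, hp⟩
  refine ⟨F k, W, hWo, hqW, fun x hx => ?_⟩
  rw [hF k ⟨x, hWU hx⟩ hx]
  exact mul_inv_cancel₀ (hWU hx)

end Bump

/-! ### Formal series -/

section FormalShift

variable {V : Type*} [AddCommGroup V]

/-- Multiplication of a formal power series with the formal parameter. -/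
def formalShift (v : ℕ → V) : ℕ → V
  | 0 => 0
  | m + 1 => v m

theorem formalShift_zero (v : ℕ → V) : formalShift v 0 = 0 := rfl

theorem formalShift_succ (v : ℕ → V) (m : ℕ) : formalShift v (m + 1) = v m := rfl

theorem constSeries_zero (v : V) : constSeries v 0 = v := rfl

theorem constSeries_succ (v : V) (m : ℕ) : constSeries v (m + 1) = 0 := rfl

theorem constSeries_add (v w : V) : constSeries (v + w) = constSeries v + constSeries w :=
  Pi.single_add (f := fun _ : ℕ => V) 0 v w

theorem eq_constSeries_add_formalShift (v : ℕ → V) :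
    v = constSeries (v 0) + formalShift (fun m => v (m + 1)) := by
  funext m
  cases m with
  | zero => simp [constSeries_zero, formalShift_zero]
  | succ m => simp [constSeries_succ, formalShift_succ]

end FormalShift

section Formal

variable {U V W : Type*} [AddCommGroup U] [Module ℂ U] [AddCommGroup V] [Module ℂ V]
  [AddCommGroup W] [Module ℂ W]

theorem constSeries_smul (c : ℂ) (v : V) : constSeries (c • v) = c • constSeries v :=
  Pi.single_smul (f := fun _ : ℕ => V) 0 c v

theorem formalMul_smul_left (C : ℕ → U →ₗ[ℂ] V →ₗ[ℂ] W) (c : ℂ) (u : ℕ → U) (v : ℕ → V) :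
    formalMul C (c • u) v = c • formalMul C u v := by
  funext m
  simp [formalMul, Finset.smul_sum]

theorem formalMul_smul_right (C : ℕ → U →ₗ[ℂ] V →ₗ[ℂ] W) (c : ℂ) (u : ℕ → U) (v : ℕ → V) :
    formalMul C u (c • v) = c • formalMul C u v := by
  funext m
  simp [formalMul, Finset.smul_sum]

theorem formalMul_sub_right (C : ℕ → U →ₗ[ℂ] V →ₗ[ℂ] W) (u : ℕ → U) (v v' : ℕ → V) :
    formalMul C u (v - v') = formalMul C u v - formalMul C u v' := by
  funext m
  simp [formalMul, Finset.sum_sub_distrib]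

theorem formalMul_formalShift_left (C : ℕ → U →ₗ[ℂ] V →ₗ[ℂ] W) (u : ℕ → U) (v : ℕ → V) :
    formalMul C (formalShift u) v = formalShift (formalMul C u v) := by
  funext m
  cases m with
  | zero => simp [formalMul, formalShift_zero]
  | succ m =>
    simp [formalMul, formalShift_zero, formalShift_succ, Finset.Nat.sum_antidiagonal_succ',
      Finset.Nat.sum_antidiagonal_succ (f := fun q => C _ (formalShift u q.1) (v q.2))]

theorem formalMul_formalShift_right (C : ℕ → U →ₗ[ℂ] V →ₗ[ℂ] W) (u : ℕ → U) (v : ℕ → V) :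
    formalMul C u (formalShift v) = formalShift (formalMul C u v) := by
  funext m
  cases m with
  | zero => simp [formalMul, formalShift_zero]
  | succ m =>
    simp [formalMul, formalShift_zero, formalShift_succ, Finset.Nat.sum_antidiagonal_succ']

theorem formalMul_at_zero (C : ℕ → U →ₗ[ℂ] V →ₗ[ℂ] W) (u : ℕ → U) (v : ℕ → V) :
    formalMul C u v 0 = C 0 (u 0) (v 0) := by
  simp [formalMul]

theorem formalMul_constSeries (C : ℕ → U →ₗ[ℂ] V →ₗ[ℂ] W) (u : U) (v : V) (m : ℕ) :
    formalMul C (constSeries u) (constSeries v) m = C m u v := by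
  rw [formalMul, Finset.sum_eq_single (m, 0)]
  · simp [constSeries_zero]
  · rintro ⟨r, k⟩ hrk hne
    refine Finset.sum_eq_zero fun ⟨i, j⟩ hq => ?_
    rw [Finset.HasAntidiagonal.mem_antidiagonal] at hq hrk
    cases i with
    | succ i => simp [constSeries_succ]
    | zero =>
      cases j with
      | succ j => simp [constSeries_succ]
      | zero =>
        obtain rfl : k = 0 := by simpa using hq.symm
        obtain rfl : r = m := by simpa using hrk
        exact absurd rfl hne
  · intro h
    exact absurd (by simp) h

/-- An additive map commuting with the formal parameter is given by a formal series of maps. -/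
theorem eq_formalApply (F : (ℕ → V) →+ (ℕ → W)) (hF : ∀ v, F (formalShift v) = formalShift (F v))
    (T : ℕ → V →ₗ[ℂ] W) (hT : ∀ r v, T r v = F (constSeries v) r) (v : ℕ → V) :
    F v = formalApply T v := by
  funext m
  induction m generalizing v with
  | zero =>
    conv_lhs => rw [eq_constSeries_add_formalShift v, map_add, hF]
    simp [formalApply, hT, formalShift_zero]
  | succ m ih =>
    -- Coefficient m + 1 of λ · F(tail of v) is coefficient m of F(tail of v), to which the
    -- induction hypothesis applies.
    conv_lhs => rw [eq_constSeries_add_formalShift v, map_add, hF]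
    rw [Pi.add_apply, formalShift_succ, ih, formalApply, formalApply,
      Finset.Nat.sum_antidiagonal_succ', hT, add_comm]

end Formal

/-! ### Local operators and the calculus of orders -/

section Local

variable {n : ℕ} {M : Type*} [TopologicalSpace M] [ChartedSpace (EuclideanSpace ℝ (Fin n)) M]

/-- `D` does not enlarge supports on open subsets of `V`. -/
def IsLocalOn (V : Set M) (D : SmoothFun n M →ₗ[ℂ] SmoothFun n M) : Prop :=
  ∀ W ⊆ V, IsOpen W → ∀ f : SmoothFun n M, (∀ x ∈ W, f x = 0) → ∀ x ∈ W, D f x = 0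

theorem IsLocalOn.congr {V : Set M} {D : SmoothFun n M →ₗ[ℂ] SmoothFun n M} (hD : IsLocalOn V D)
    {W : Set M} (hWV : W ⊆ V) (hW : IsOpen W) {f g : SmoothFun n M} (h : ∀ x ∈ W, f x = g x) :
    ∀ x ∈ W, D f x = D g x := by
  intro x hx
  have := hD W hWV hW (f - g) (fun y hy => by rw [SmoothFun.sub_apply, h y hy, sub_self]) x hx
  rwa [map_sub, SmoothFun.sub_apply, sub_eq_zero] at this

theorem mulCommutator_apply (D : SmoothFun n M →ₗ[ℂ] SmoothFun n M) (a f : SmoothFun n M) :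
    mulCommutator D a f = D (a * f) - a * D f := rfl

theorem mulCommutator_add (D D' : SmoothFun n M →ₗ[ℂ] SmoothFun n M) (a : SmoothFun n M) :
    mulCommutator (D + D') a = mulCommutator D a + mulCommutator D' a := by
  refine LinearMap.ext fun f => ?_
  simp only [mulCommutator_apply, LinearMap.add_apply, mul_add]
  abel

theorem mulCommutator_comp (D D' : SmoothFun n M →ₗ[ℂ] SmoothFun n M) (a : SmoothFun n M) :
    mulCommutator (D ∘ₗ D') a = D ∘ₗ mulCommutator D' a + mulCommutator D a ∘ₗ D' := by
  refine LinearMap.ext fun f => ?_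
  simp only [mulCommutator_apply, LinearMap.add_apply, LinearMap.comp_apply, map_sub]
  abel

/-- Commuting with `a` does not change the value at `f` and `q`, so this value equals that of an
iterated commutator, which is zero. -/
theorem HasOrderLEOn.apply_eq_zero {V : Set M} {q : M} (hq : q ∈ V) {a f : SmoothFun n M}
    (haf : a * f = f) (ha : a q = 0) {k : ℕ} {D : SmoothFun n M →ₗ[ℂ] SmoothFun n M}
    (hD : HasOrderLEOn V k D) : D f q = 0 := by
  have key (D : SmoothFun n M →ₗ[ℂ] SmoothFun n M) : mulCommutator D a f q = D f q := by
    rw [mulCommutator_apply, haf, SmoothFun.sub_apply, SmoothFun.mul_apply, ha, zero_mul, sub_zero]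
  induction k generalizing D with
  | zero => exact (key D).symm.trans (hD a f q hq)
  | succ k ih => exact (key D).symm.trans (ih (hD a))

/-- `D` has order less than `m` on `V`, where the operators of order less than `0` vanish. -/
def HasOrderLTOn (V : Set M) : ℕ → (SmoothFun n M →ₗ[ℂ] SmoothFun n M) → Prop
  | 0, D => ∀ f, ∀ x ∈ V, D f x = 0
  | m + 1, D => ∀ a, HasOrderLTOn V m (mulCommutator D a)

/-- The shifted index lets inductions start at operators that vanish on `V`. -/
theorem hasOrderLEOn_iff {V : Set M} {k : ℕ} {D : SmoothFun n M →ₗ[ℂ] SmoothFun n M} :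
    HasOrderLEOn V k D ↔ HasOrderLTOn V (k + 1) D := by
  induction k generalizing D with
  | zero => exact Iff.rfl
  | succ k ih => exact forall_congr' fun a => ih

theorem HasOrderLTOn.of_eq_zero {V : Set M} {D : SmoothFun n M →ₗ[ℂ] SmoothFun n M}
    (hD : ∀ f, ∀ x ∈ V, D f x = 0) (m : ℕ) : HasOrderLTOn V m D := by
  induction m generalizing D with
  | zero => exact hD
  | succ m ih =>
    refine fun a => ih fun f x hx => ?_
    rw [mulCommutator_apply, SmoothFun.sub_apply, SmoothFun.mul_apply, hD _ x hx, hD _ x hx,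
      mul_zero, sub_zero]

theorem HasOrderLTOn.mono {V W : Set M} (hWV : W ⊆ V) {m l : ℕ} (hml : m ≤ l)
    {D : SmoothFun n M →ₗ[ℂ] SmoothFun n M} (hD : HasOrderLTOn V m D) : HasOrderLTOn W l D := by
  induction m generalizing l D with
  | zero => exact HasOrderLTOn.of_eq_zero (fun f x hx => hD f x (hWV hx)) l
  | succ m ih =>
    obtain ⟨l, rfl⟩ : ∃ l', l = l' + 1 := ⟨l - 1, by omega⟩
    exact fun a => ih (by omega) (hD a)

theorem HasOrderLTOn.add {V : Set M} {m : ℕ} {D D' : SmoothFun n M →ₗ[ℂ] SmoothFun n M}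
    (hD : HasOrderLTOn V m D) (hD' : HasOrderLTOn V m D') : HasOrderLTOn V m (D + D') := by
  induction m generalizing D D' with
  | zero =>
    intro f x hx
    rw [LinearMap.add_apply, SmoothFun.add_apply, hD f x hx, hD' f x hx, add_zero]
  | succ m ih =>
    intro a
    rw [mulCommutator_add]
    exact ih (hD a) (hD' a)

theorem HasOrderLTOn.congr {V : Set M} {m : ℕ} {D D' : SmoothFun n M →ₗ[ℂ] SmoothFun n M}
    (hD : HasOrderLTOn V m D) (h : ∀ f, ∀ x ∈ V, D' f x = D f x) : HasOrderLTOn V m D' := by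
  have := hD.add (HasOrderLTOn.of_eq_zero (D := D' - D) (V := V) (fun f x hx => by
    rw [LinearMap.sub_apply, SmoothFun.sub_apply, h f x hx, sub_self]) m)
  rwa [add_sub_cancel] at this

theorem HasOrderLTOn.sum {V : Set M} {m : ℕ} {ι : Type*} (t : Finset ι)
    {D : ι → SmoothFun n M →ₗ[ℂ] SmoothFun n M} (hD : ∀ i ∈ t, HasOrderLTOn V m (D i)) :
    HasOrderLTOn V m (∑ i ∈ t, D i) :=
  Finset.sum_induction D (HasOrderLTOn V m) (fun _ _ => HasOrderLTOn.add)
    (HasOrderLTOn.of_eq_zero (fun _ _ _ => rfl) m) hD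

theorem HasOrderLTOn.of_forall_singleton {V : Set M} {m : ℕ}
    {D : SmoothFun n M →ₗ[ℂ] SmoothFun n M} (hD : ∀ q ∈ V, HasOrderLTOn {q} m D) :
    HasOrderLTOn V m D := by
  induction m generalizing D with
  | zero => exact fun f x hx => hD x hx f x rfl
  | succ m ih => exact fun a => ih fun q hq => hD q hq a

/-- Take `a = 1 - χ` with a bump function `χ` supported in `W`. This puts vanishing near `q` into an
algebraic form on which commutators and the Leibniz rule can act. -/
theorem SmoothFun.exists_mul_eq_self [IsManifold (𝓡 n) ∞ M] [T2Space M] {W : Set M}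
    (hW : IsOpen W) {q : M} (hq : q ∈ W) {f : SmoothFun n M} (hf : ∀ x ∈ W, f x = 0) :
    ∃ a : SmoothFun n M, a * f = f ∧ a q = 0 := by
  obtain ⟨χ, N, -, hqN, -, h1, hχ⟩ := SmoothFun.exists_bump (n := n) hW hq
  refine ⟨1 - χ, ContMDiffMap.ext fun x => ?_, ?_⟩
  · rw [SmoothFun.mul_apply, SmoothFun.sub_apply, SmoothFun.one_apply]
    by_cases hx : x ∈ W
    · rw [hf x hx, mul_zero]
    · rw [Function.notMem_support.1 fun h => hx (hχ (subset_closure h)), sub_zero, one_mul]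
  · rw [SmoothFun.sub_apply, SmoothFun.one_apply, h1 q hqN, sub_self]

variable [IsManifold (𝓡 n) ∞ M] [T2Space M]

theorem HasOrderLEOn.isLocalOn {V : Set M} {k : ℕ} {D : SmoothFun n M →ₗ[ℂ] SmoothFun n M}
    (hD : HasOrderLEOn V k D) : IsLocalOn V D := by
  intro W hWV hW f hf x hx
  obtain ⟨a, haf, ha⟩ := SmoothFun.exists_mul_eq_self hW hx hf
  exact hD.apply_eq_zero (hWV hx) haf ha

theorem HasOrderLTOn.isLocalOn {V : Set M} {m : ℕ} {D : SmoothFun n M →ₗ[ℂ] SmoothFun n M}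
    (hD : HasOrderLTOn V m D) : IsLocalOn V D :=
  (hasOrderLEOn_iff.2 (hD.mono subset_rfl m.le_succ)).isLocalOn

/-- The commutator with `a` is a derivation for composition, which gives a double induction. If `D'`
vanishes on `V`, locality of `D` on the open set `V` is what makes the composition vanish. The bound
is not sharp, but only finiteness matters. -/
theorem HasOrderLTOn.comp {V : Set M} (hV : IsOpen V) {m l : ℕ}
    {D D' : SmoothFun n M →ₗ[ℂ] SmoothFun n M} (hD : HasOrderLTOn V m D)
    (hD' : HasOrderLTOn V l D') : HasOrderLTOn V (m + l) (D ∘ₗ D') := by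
  induction m generalizing l D D' with
  | zero => exact HasOrderLTOn.of_eq_zero (D := D ∘ₗ D') (fun f x hx => hD (D' f) x hx) _
  | succ m ih =>
    induction l generalizing D D' with
    | zero =>
      exact HasOrderLTOn.of_eq_zero
        (fun f x hx => hD.isLocalOn V subset_rfl hV _ (fun y hy => hD' f y hy) x hx) _
    | succ l ih' =>
      intro a
      rw [mulCommutator_comp]
      refine (ih' hD (hD' a)).add ?_
      have := ih (hD a) hD'
      rwa [show m + 1 + l = m + (l + 1) by omega]

theorem IsBidifferentialOperator.isLocalOn_right
    {C : SmoothFun n M →ₗ[ℂ] SmoothFun n M →ₗ[ℂ] SmoothFun n M}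
    (hC : IsBidifferentialOperator C) (f : SmoothFun n M) : IsLocalOn Set.univ (C f) := by
  intro W _ hW g hg x hx
  obtain ⟨V, hV, hxV, k, h1, -⟩ := hC x
  exact (h1 f).isLocalOn (W ∩ V) Set.inter_subset_right (hW.inter hV) g
    (fun y hy => hg y hy.1) x ⟨hx, hxV⟩

theorem IsBidifferentialOperator.isLocalOn_left
    {C : SmoothFun n M →ₗ[ℂ] SmoothFun n M →ₗ[ℂ] SmoothFun n M}
    (hC : IsBidifferentialOperator C) (g : SmoothFun n M) : IsLocalOn Set.univ (C.flip g) := by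
  intro W _ hW f hf x hx
  obtain ⟨V, hV, hxV, k, -, h2⟩ := hC x
  exact (h2 g).isLocalOn (W ∩ V) Set.inter_subset_right (hW.inter hV) f
    (fun y hy => hf y hy.1) x ⟨hx, hxV⟩

end Local

/-! ### Locality and cancellation for formal series -/

section Series

variable {n : ℕ} {M : Type*} [TopologicalSpace M] [ChartedSpace (EuclideanSpace ℝ (Fin n)) M]

/-- All coefficients of the formal series agree on `W`. -/
def AgreeOn (W : Set M) (a b : ℕ → SmoothFun n M) : Prop := ∀ r, ∀ x ∈ W, a r x = b r x

theorem AgreeOn.symm {W : Set M} {a b : ℕ → SmoothFun n M} (h : AgreeOn W a b) : AgreeOn W b a :=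
  fun r x hx => (h r x hx).symm

theorem AgreeOn.trans {W : Set M} {a b c : ℕ → SmoothFun n M} (h : AgreeOn W a b)
    (h' : AgreeOn W b c) : AgreeOn W a c :=
  fun r x hx => (h r x hx).trans (h' r x hx)

theorem agreeOn_formalMul {C : ℕ → SmoothFun n M →ₗ[ℂ] SmoothFun n M →ₗ[ℂ] SmoothFun n M}
    (hl : ∀ r g, IsLocalOn Set.univ ((C r).flip g)) (hr : ∀ r f, IsLocalOn Set.univ (C r f))
    {W : Set M} (hW : IsOpen W) {a b a' b' : ℕ → SmoothFun n M}
    (ha : AgreeOn W a a') (hb : AgreeOn W b b') :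
    AgreeOn W (formalMul C a b) (formalMul C a' b') := by
  intro m x hx
  simp only [formalMul, SmoothFun.sum_apply]
  refine Finset.sum_congr rfl fun p _ => Finset.sum_congr rfl fun q _ => ?_
  exact ((hl p.1 (b q.2)).congr (Set.subset_univ W) hW (ha q.1) x hx).trans
    ((hr p.1 (a' q.1)).congr (Set.subset_univ W) hW (hb q.2) x hx)

theorem agreeOn_formalApply {T : ℕ → SmoothFun n M →ₗ[ℂ] SmoothFun n M} {V : Set M}
    (hT : ∀ r, IsLocalOn V (T r)) {W : Set M} (hWV : W ⊆ V) (hW : IsOpen W)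
    {a b : ℕ → SmoothFun n M} (ha : AgreeOn W a b) :
    AgreeOn W (formalApply T a) (formalApply T b) := by
  intro m x hx
  simp only [formalApply, SmoothFun.sum_apply]
  exact Finset.sum_congr rfl fun p _ => (hT p.1).congr hWV hW (ha p.2) x hx

/-- A formal series of local operators whose leading term is the identity is injective. -/
theorem AgreeOn.of_formalApply {T : ℕ → SmoothFun n M →ₗ[ℂ] SmoothFun n M} {W : Set M}
    (hW : IsOpen W) (hT : ∀ r, IsLocalOn W (T r)) (hT0 : ∀ f, ∀ x ∈ W, T 0 f x = f x)
    {a b : ℕ → SmoothFun n M} (h : AgreeOn W (formalApply T a) (formalApply T b)) :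
    AgreeOn W a b := by
  intro m
  induction m using Nat.strong_induction_on with
  | _ m ih =>
    intro x hx
    have := h m x hx
    simp only [formalApply, SmoothFun.sum_apply] at this
    -- The term with `T 0` isolates coefficient m; all the others involve lower coefficients, which
    -- agree already.
    rw [← Finset.add_sum_erase _ _ (show (0, m) ∈ Finset.HasAntidiagonal.antidiagonal m by simp),
      ← Finset.add_sum_erase _ _ (show (0, m) ∈ Finset.HasAntidiagonal.antidiagonal m by simp),
      hT0 _ x hx, hT0 _ x hx] at this
    refine add_right_cancel (this.trans (congrArg _ (Finset.sum_congr rfl ?_)))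
    rintro ⟨i, j⟩ hij
    rw [Finset.mem_erase, Finset.HasAntidiagonal.mem_antidiagonal] at hij
    refine ((hT i).congr subset_rfl hW (ih j ?_) x hx).symm
    have h1 := hij.1
    have h2 : i + j = m := hij.2
    rcases Nat.eq_zero_or_pos i with rfl | hi
    · exact absurd (by simpa using h2) (by simpa using h1)
    · omega

end Series

section StarLocal

variable {n : ℕ} {M : Type*} [TopologicalSpace M] [ChartedSpace (EuclideanSpace ℝ (Fin n)) M]
  [IsManifold (𝓡 n) ∞ M] [T2Space M] {P : PoissonStructure n M} (s : StarProduct P)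

theorem StarProduct.isLocalOn_left (r : ℕ) (g : SmoothFun n M) :
    IsLocalOn Set.univ ((s.C r).flip g) :=
  (s.bidifferential r).isLocalOn_left g

theorem StarProduct.isLocalOn_right (r : ℕ) (f : SmoothFun n M) :
    IsLocalOn Set.univ (s.C r f) :=
  (s.bidifferential r).isLocalOn_right f

theorem StarProduct.agreeOn_formalMul {W : Set M} (hW : IsOpen W) {a b a' b' : ℕ → SmoothFun n M}
    (ha : AgreeOn W a a') (hb : AgreeOn W b b') :
    AgreeOn W (formalMul s.C a b) (formalMul s.C a' b') :=
  DeformationQuantization.agreeOn_formalMul s.isLocalOn_left s.isLocalOn_right hW ha hb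

/-- Right cancellation of a formal series whose leading term does not vanish. -/
theorem StarProduct.agreeOn_zero_of_mul {W : Set M} (hW : IsOpen W) {u v : ℕ → SmoothFun n M}
    (hv : ∀ x ∈ W, v 0 x ≠ 0) (h : AgreeOn W (formalMul s.C u v) 0) : AgreeOn W u 0 := by
  intro m
  induction m using Nat.strong_induction_on with
  | _ m ih =>
    intro x hx
    have hm : formalMul s.C u v m x = 0 := h m x hx
    -- By locality every term with a lower coefficient of `u` drops out, which leaves the pointwise
    -- product of `u m` and `v 0`.
    have hlow : ∀ r i j, i < m → s.C r (u i) (v j) x = 0 := fun r i j hi =>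
      s.isLocalOn_left r (v j) W (Set.subset_univ W) hW _ (ih i hi) x hx
    simp only [formalMul, SmoothFun.sum_apply] at hm
    rw [Finset.sum_eq_single (0, m), Finset.sum_eq_single (m, 0), s.C_zero,
      SmoothFun.mul_apply] at hm
    · exact (mul_eq_zero.1 hm).resolve_right (hv x hx)
    · rintro ⟨i, j⟩ hij hne
      have h2 : i + j = m := Finset.HasAntidiagonal.mem_antidiagonal.1 hij
      refine hlow _ _ _ (lt_of_le_of_ne (by omega) ?_)
      rintro rfl
      exact hne (Prod.ext rfl (by simpa using h2))
    · exact fun h => absurd (by simp) h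
    · rintro ⟨r, k⟩ hrk hne
      have h2 : r + k = m := Finset.HasAntidiagonal.mem_antidiagonal.1 hrk
      refine Finset.sum_eq_zero fun ⟨i, j⟩ hij => ?_
      have h3 : i + j = k := Finset.HasAntidiagonal.mem_antidiagonal.1 hij
      refine hlow _ _ _ (lt_of_le_of_ne (by omega) ?_)
      rintro rfl
      exact hne (Prod.ext (by simp; omega) (by simp; omega))
    · exact fun h => absurd (by simp) h

end StarLocal

/-! ### Local right inverses for the star product -/

section Inverse

/-- The sequence whose `m`-th entry is computed by `F m` from the preceding ones, continued by
`z`. -/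
def strongSeq {α : Type*} (F : ℕ → (ℕ → α) → α) (z : α) (m : ℕ) : α :=
  F m (fun j => if _h : j < m then strongSeq F z j else z)

theorem formalMul_of_forall_lt {U V W : Type*} [AddCommGroup U] [Module ℂ U] [AddCommGroup V]
    [Module ℂ V] [AddCommGroup W] [Module ℂ W] (C : ℕ → U →ₗ[ℂ] V →ₗ[ℂ] W) (u : ℕ → U) (v : ℕ → V)
    {m : ℕ} (hv : ∀ j < m, v j = 0) : formalMul C u v m = C 0 (u 0) (v m) := by
  rw [formalMul, Finset.sum_eq_single (0, m), Finset.sum_eq_single (0, m)]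
  · rintro ⟨i, j⟩ hij hne
    have h2 : i + j = m := Finset.HasAntidiagonal.mem_antidiagonal.1 hij
    rw [hv j (lt_of_le_of_ne (by omega) ?_), map_zero]
    rintro rfl
    exact hne (Prod.ext (by simpa using h2) rfl)
  · exact fun h => absurd (by simp) h
  · rintro ⟨r, k⟩ hrk hne
    have h2 : r + k = m := Finset.HasAntidiagonal.mem_antidiagonal.1 hrk
    refine Finset.sum_eq_zero fun ⟨i, j⟩ hij => ?_
    have h3 : i + j = k := Finset.HasAntidiagonal.mem_antidiagonal.1 hij
    rw [hv j (lt_of_le_of_ne (by omega) ?_), map_zero]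
    rintro rfl
    exact hne (Prod.ext (by simp; omega) (by simp; omega))
  · exact fun h => absurd (by simp) h

variable {n : ℕ} {M : Type*} [TopologicalSpace M] [ChartedSpace (EuclideanSpace ℝ (Fin n)) M]
  [IsManifold (𝓡 n) ∞ M] [T2Space M] {P : PoissonStructure n M} (s : StarProduct P)

theorem StarProduct.exists_right_inverse (g : ℕ → SmoothFun n M) {p : M} (hp : g 0 p ≠ 0) :
    ∃ c : ℕ → SmoothFun n M, ∃ W : Set M, IsOpen W ∧ p ∈ W ∧
      AgreeOn W (formalMul s.C g c) (constSeries 1) := by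
  obtain ⟨h, W, hW, hpW, hh⟩ := SmoothFun.exists_local_inverse (g 0) hp
  -- This solves the order m part of g ⋆ c = 1, namely g₀ cₘ + (g ⋆ d)ₘ = 1ₘ, where `d` is `c` cut
  -- off below m.
  let F : ℕ → (ℕ → SmoothFun n M) → SmoothFun n M := fun m d =>
    h * (constSeries 1 m - formalMul s.C g d m)
  let c : ℕ → SmoothFun n M := strongSeq F 0
  refine ⟨c, W, hW, hpW, fun m x hx => ?_⟩
  let d : ℕ → SmoothFun n M := fun j => if _h : j < m then c j else 0
  have hc : c m = h * (constSeries 1 m - formalMul s.C g d m) := by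
    change strongSeq F 0 m = _
    rw [strongSeq]
  have h1 : formalMul s.C g (c - d) m = g 0 * c m := by
    rw [formalMul_of_forall_lt, s.C_zero]
    · simp [d]
    · intro j hj
      simp [d, hj]
  rw [formalMul_sub_right, Pi.sub_apply, sub_eq_iff_eq_add] at h1
  rw [h1, hc, ← mul_assoc, SmoothFun.add_apply, SmoothFun.mul_apply, SmoothFun.mul_apply, hh x hx,
    one_mul, SmoothFun.sub_apply, sub_add_cancel]

end Inverse

/-- A formal power series of smooth functions as an element of the deformed algebra. -/
def StarProduct.ofSeries {n : ℕ} {M : Type*} [TopologicalSpace M]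
    [ChartedSpace (EuclideanSpace ℝ (Fin n)) M] {P : PoissonStructure n M} (s : StarProduct P)
    (f : ℕ → SmoothFun n M) : s.Alg := f

/-- The coefficients of an element of the deformed algebra. -/
def StarProduct.coeffs {n : ℕ} {M : Type*} [TopologicalSpace M]
    [ChartedSpace (EuclideanSpace ℝ (Fin n)) M] {P : PoissonStructure n M} (s : StarProduct P)
    (f : s.Alg) : ℕ → SmoothFun n M := f

/-! ### From an equivalence bimodule to a formal series of operators -/

namespace DeformedBimodule

open MulOpposite

variable {n : ℕ} {M : Type*} [TopologicalSpace M] [ChartedSpace (EuclideanSpace ℝ (Fin n)) M]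
  {P' P : PoissonStructure n M} {s' : StarProduct P'} {s : StarProduct P}
  {E : Type*} [AddCommGroup E] [Module ℂ E] [Module (SmoothFun n M) E]
  (B : DeformedBimodule s' s E)

/-- A formal power series as an element of the deformed bimodule. -/
def ofSeries (z : ℕ → E) : B.Carrier := z

/-- The coefficients of an element of the deformed bimodule. -/
def coeffs (z : B.Carrier) : ℕ → E := z

/-- The right linear endomorphism `z ↦ e · φ z`. -/
noncomputable def rankOne (φ : B.Carrier →ₗ[(s.Alg)ᵐᵒᵖ] s.Alg) (e : B.Carrier) :
    Module.End (s.Alg)ᵐᵒᵖ B.Carrier where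
  toFun z := op (φ z) • e
  map_add' y z := by rw [map_add, op_add, add_smul]
  map_smul' a z := by
    rw [map_smul, RingHom.id_apply, ← op_unop a, op_smul_eq_mul, op_mul, mul_smul]

/-- Around every point there is a right linear functional not vanishing there whose rank one
endomorphisms are given by the left action. -/
theorem exists_rankOne_eq_smul (hB : B.IsEquivalenceBimodule ∨ B.IsStarEquivalenceBimodule)
    (p : M) : ∃ (φ : B.Carrier →ₗ[(s.Alg)ᵐᵒᵖ] s.Alg) (e : B.Carrier), s.coeffs (φ e) 0 p ≠ 0 ∧
      ∀ e' : B.Carrier, ∃ b : s'.Alg, ∀ z : B.Carrier, op (φ z) • e' = b • z := by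
  let ev : s.Alg →+ ℂ :=
    { toFun := fun a => s.coeffs a 0 p
      map_zero' := rfl
      map_add' := fun _ _ => rfl }
  have ev_one : ev 1 = 1 := rfl
  rcases hB with hB | ⟨-, -, h, Θ, -, -, -, -, -, -, hΘ, hfull, -⟩
  -- The generator property writes 1 as a sum of values of functionals; one summand is nonzero at
  -- `p` in order zero.
  · obtain ⟨m, ψ, hψ⟩ := hB.generator
    obtain ⟨x, hx⟩ := hψ 1
    have hsum : ∑ i, ev (ψ (Pi.single i (x i))) = 1 := by
      rw [← map_sum, ← map_sum, Finset.univ_sum_single, hx, ev_one]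
    obtain ⟨i, -, hi⟩ := Finset.exists_ne_zero_of_sum_ne_zero
      (hsum.trans_ne one_ne_zero)
    refine ⟨ψ ∘ₗ LinearMap.single (s.Alg)ᵐᵒᵖ (fun _ => B.Carrier) i, x i, hi, fun e' => ?_⟩
    obtain ⟨b, hb⟩ := hB.endomorphisms.2
      (B.rankOne (ψ ∘ₗ LinearMap.single (s.Alg)ᵐᵒᵖ (fun _ => B.Carrier) i) e')
    exact ⟨b, fun z => (LinearMap.congr_fun hb z).symm⟩
  -- Otherwise all values of `h`, hence by fullness the unit too, would lie in the kernel of `ev`.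
  · obtain ⟨y, x, hyx⟩ : ∃ y x, ev (h y x) ≠ 0 := by
      by_contra! hcon
      have hle : AddSubgroup.closure {a | ∃ x y, h x y = a} ≤ ev.ker := by
        rw [AddSubgroup.closure_le]
        rintro _ ⟨x, y, rfl⟩
        exact hcon x y
      rw [hfull] at hle
      exact one_ne_zero (ev_one.symm.trans (hle (AddSubgroup.mem_top 1)))
    exact ⟨h y, x, hyx, fun e' => ⟨Θ e' y, fun z => (hΘ e' y z).symm⟩⟩

/-- The formal parameter acts as the algebra element λ · 1 from the right, so right linearity
includes linearity in λ. -/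
theorem map_formalShift (φ : B.Carrier →ₗ[(s.Alg)ᵐᵒᵖ] s.Alg) (z : ℕ → E) :
    φ (B.ofSeries (formalShift z)) =
      s.ofSeries (formalShift (s.coeffs (φ (B.ofSeries z)))) := by
  have h1 : B.ofSeries (formalShift z) =
      op (s.ofSeries (formalShift (constSeries 1))) • B.ofSeries z :=
    ((formalMul_formalShift_right B.R z _).trans (congrArg formalShift (B.right_one z))).symm
  rw [h1, map_smul, op_smul_eq_mul]
  exact (formalMul_formalShift_right s.C _ _).trans (congrArg formalShift (s.star_one _))

theorem map_complex_smul (φ : B.Carrier →ₗ[(s.Alg)ᵐᵒᵖ] s.Alg) (c : ℂ) (z : ℕ → E) :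
    φ (B.ofSeries (c • z)) = s.ofSeries (c • s.coeffs (φ (B.ofSeries z))) := by
  have h1 : B.ofSeries (c • z) = op (s.ofSeries (c • constSeries 1)) • B.ofSeries z :=
    ((formalMul_smul_right B.R c z _).trans (congrArg (c • ·) (B.right_one z))).symm
  rw [h1, map_smul, op_smul_eq_mul]
  exact (formalMul_smul_right s.C c _ _).trans (congrArg (c • ·) (s.star_one _))

/-- The formal series of linear maps which represents `a ↦ φ (a · e)`. -/
noncomputable def coefficient (φ : B.Carrier →ₗ[(s.Alg)ᵐᵒᵖ] s.Alg) (e : B.Carrier) (r : ℕ) :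
    SmoothFun n M →ₗ[ℂ] SmoothFun n M where
  toFun f := s.coeffs (φ (s'.ofSeries (constSeries f) • e)) r
  map_add' f g := by
    have h1 : s'.ofSeries (constSeries (f + g)) =
      s'.ofSeries (constSeries f) + s'.ofSeries (constSeries g) := constSeries_add f g
    rw [h1, add_smul, map_add]
    rfl
  map_smul' c f := by
    have h1 : s'.ofSeries (constSeries (c • f)) • e =
        B.ofSeries (c • B.coeffs (s'.ofSeries (constSeries f) • e)) :=
      (congrArg (fun u => formalMul B.L u e) (constSeries_smul c f)).trans
        (formalMul_smul_left B.L c _ e)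
    rw [h1, map_complex_smul]
    rfl

theorem formalApply_coefficient (φ : B.Carrier →ₗ[(s.Alg)ᵐᵒᵖ] s.Alg) (e : B.Carrier)
    (a : ℕ → SmoothFun n M) :
    formalApply (B.coefficient φ e) a = s.coeffs (φ (s'.ofSeries a • e)) := by
  let F : (ℕ → SmoothFun n M) →+ (ℕ → SmoothFun n M) :=
    { toFun := fun a => s.coeffs (φ (s'.ofSeries a • e))
      map_zero' := (congrArg φ (zero_smul s'.Alg e)).trans (map_zero φ)
      map_add' := fun a a' => (congrArg φ (add_smul (s'.ofSeries a) (s'.ofSeries a') e)).trans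
        (map_add φ _ _) }
  refine (eq_formalApply F (fun v => ?_) (B.coefficient φ e) (fun r v => rfl) a).symm
  exact (congrArg φ (formalMul_formalShift_left B.L v e)).trans (B.map_formalShift φ _)

/-- Both undeformed actions coincide, so f·e and e·f differ by a multiple of λ, which φ cannot bring
into order zero; and φ(e·f) = φ(e) ⋆ f. -/
theorem coefficient_zero (φ : B.Carrier →ₗ[(s.Alg)ᵐᵒᵖ] s.Alg) (e : B.Carrier)
    (f : SmoothFun n M) : B.coefficient φ e 0 f = s.coeffs (φ e) 0 * f := by
  let x : ℕ → E := formalMul B.L (constSeries f) (B.coeffs e)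
  let y : ℕ → E := formalMul B.R (B.coeffs e) (constSeries f)
  have h0 : (x - y) 0 = 0 := by
    simp [x, y, formalMul_at_zero, B.L_zero, B.R_zero, constSeries_zero]
  have h1 : x = y + formalShift (fun m => (x - y) (m + 1)) := by
    rw [← sub_eq_iff_eq_add']
    funext m
    cases m with
    | zero => exact h0
    | succ m => rfl
  have h2 : φ (B.ofSeries x) =
      φ (B.ofSeries y) + φ (B.ofSeries (formalShift (fun m => (x - y) (m + 1)))) :=
    (congrArg φ h1).trans (map_add φ (B.ofSeries y) _)
  have h3 : φ (B.ofSeries y) = φ e * s.ofSeries (constSeries f) :=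
    map_smul φ (op (s.ofSeries (constSeries f))) e
  rw [map_formalShift, h3] at h2
  refine (congrFun h2 0).trans ?_
  change formalMul s.C (s.coeffs (φ e)) (constSeries f) 0 + formalShift _ 0 = _
  rw [formalMul_at_zero, formalShift_zero, add_zero, s.C_zero, constSeries_zero]

variable [IsManifold (𝓡 n) ∞ M] [T2Space M]

/-- Locally, an equivalence bimodule gives a formal series of linear maps starting with the
identity which is unital and multiplicative up to a middle factor. -/
theorem exists_coefficient (hB : B.IsEquivalenceBimodule ∨ B.IsStarEquivalenceBimodule) (p : M) :
    ∃ (T : ℕ → SmoothFun n M →ₗ[ℂ] SmoothFun n M) (b : ℕ → SmoothFun n M) (W : Set M),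
      IsOpen W ∧ p ∈ W ∧ (∀ f, ∀ x ∈ W, T 0 f x = f x) ∧
      AgreeOn W (formalApply T (constSeries 1)) (constSeries 1) ∧
      ∀ a a', formalApply T (formalMul s'.C (formalMul s'.C a b) a') =
        formalMul s.C (formalApply T a) (formalApply T a') := by
  obtain ⟨φ, e, hp, hb⟩ := B.exists_rankOne_eq_smul hB p
  -- Replacing e by e·c normalises the functional: φ(e·c) = φ(e) ⋆ c = 1 near `p`.
  obtain ⟨c, W, hW, hpW, hc⟩ := s.exists_right_inverse (s.coeffs (φ e)) hp
  obtain ⟨b, hb⟩ := hb (op (s.ofSeries c) • e)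
  have h1 : AgreeOn W (s.coeffs (φ (op (s.ofSeries c) • e))) (constSeries 1) := by
    rw [map_smul, op_smul_eq_mul]
    exact hc
  refine ⟨B.coefficient φ (op (s.ofSeries c) • e), s'.coeffs b, W, hW, hpW, fun f x hx => ?_, ?_,
    fun a a' => ?_⟩
  · rw [coefficient_zero, SmoothFun.mul_apply, h1 0 x hx]
    exact one_mul _
  · rw [formalApply_coefficient]
    exact (one_smul s'.Alg (op (s.ofSeries c) • e)).symm ▸ h1
  -- With e now standing for e·c: φ(a·b·a'·e) = φ(a·(e·φ(a'·e))) = φ((a·e)·φ(a'·e)) = φ(a·e) ⋆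
  -- φ(a'·e).
  · have h2 : s'.ofSeries (formalMul s'.C (formalMul s'.C a (s'.coeffs b)) a') =
      s'.ofSeries a * b * s'.ofSeries a' := rfl
    rw [formalApply_coefficient, formalApply_coefficient, formalApply_coefficient, h2, mul_smul,
      mul_smul, ← hb, smul_comm, map_smul, op_smul_eq_mul]
    rfl

end DeformedBimodule

/-! ### Isolating the highest coefficient -/

section Truncate

variable {U V W : Type*} [AddCommGroup U] [Module ℂ U] [AddCommGroup V] [Module ℂ V]
  [AddCommGroup W] [Module ℂ W]

/-- The first `r` coefficients of a formal power series. -/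
def truncateSeries {V : Type*} [Zero V] (r : ℕ) (v : ℕ → V) : ℕ → V :=
  fun j => if j < r then v j else 0

theorem formalApply_constSeries (T : ℕ → V →ₗ[ℂ] W) (v : V) (m : ℕ) :
    formalApply T (constSeries v) m = T m v := by
  rw [formalApply, Finset.sum_eq_single (m, 0)]
  · rw [constSeries_zero]
  · rintro ⟨i, j⟩ hij hne
    have h2 : i + j = m := Finset.HasAntidiagonal.mem_antidiagonal.1 hij
    cases j with
    | zero =>
      obtain rfl : i = m := h2
      exact absurd rfl hne
    | succ j => rw [constSeries_succ, map_zero]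
  · exact fun h => absurd (by simp) h

/-- In order r, the coefficient `T r` meets only `v 0`. Splitting it off prepares the recursion for
the order of `T r`. -/
theorem formalApply_eq_truncateSeries (T : ℕ → V →ₗ[ℂ] W) (v : ℕ → V) (r : ℕ) :
    formalApply T v r = formalApply (truncateSeries r T) v r + T r (v 0) := by
  rw [formalApply, formalApply,
    ← Finset.sum_erase_add _ _ (show (r, 0) ∈ Finset.HasAntidiagonal.antidiagonal r by simp),
    ← Finset.sum_erase_add _ _ (show (r, 0) ∈ Finset.HasAntidiagonal.antidiagonal r by simp)]
  simp only [truncateSeries, lt_self_iff_false, if_false, LinearMap.zero_apply, add_zero]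
  congr 1
  refine Finset.sum_congr rfl ?_
  rintro ⟨i, j⟩ hij
  obtain ⟨hne, h2⟩ := Finset.mem_erase.1 hij
  have h2 : i + j = r := Finset.HasAntidiagonal.mem_antidiagonal.1 h2
  rw [if_pos (lt_of_le_of_ne (by omega) ?_)]
  rintro rfl
  exact hne (Prod.ext rfl (by simpa using h2))

theorem formalMul_of_forall_lt_left (C : ℕ → U →ₗ[ℂ] V →ₗ[ℂ] W) (u : ℕ → U) (v : ℕ → V)
    {m : ℕ} (hu : ∀ j < m, u j = 0) : formalMul C u v m = C 0 (u m) (v 0) := by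
  rw [formalMul, Finset.sum_eq_single (0, m), Finset.sum_eq_single (m, 0)]
  · rintro ⟨i, j⟩ hij hne
    have h2 : i + j = m := Finset.HasAntidiagonal.mem_antidiagonal.1 hij
    rw [hu i (lt_of_le_of_ne (by omega) ?_), map_zero, LinearMap.zero_apply]
    rintro rfl
    exact hne (Prod.ext rfl (by simpa using h2))
  · exact fun h => absurd (by simp) h
  · rintro ⟨r, k⟩ hrk hne
    have h2 : r + k = m := Finset.HasAntidiagonal.mem_antidiagonal.1 hrk
    refine Finset.sum_eq_zero fun ⟨i, j⟩ hij => ?_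
    have h3 : i + j = k := Finset.HasAntidiagonal.mem_antidiagonal.1 hij
    rw [hu i (lt_of_le_of_ne (by omega) ?_), map_zero, LinearMap.zero_apply]
    rintro rfl
    exact hne (Prod.ext (by simp; omega) (by simp; omega))
  · exact fun h => absurd (by simp) h

theorem formalMul_eq_truncateSeries (C : ℕ → U →ₗ[ℂ] V →ₗ[ℂ] W) (u : ℕ → U) (v : ℕ → V) (r : ℕ) :
    formalMul C u v r = formalMul C (truncateSeries r u) v r + C 0 (u r) (v 0) := by
  have h1 : u = truncateSeries r u + (u - truncateSeries r u) := (add_sub_cancel _ _).symm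
  conv_lhs => rw [h1, formalMul_add_left, Pi.add_apply]
  rw [formalMul_of_forall_lt_left C (u - truncateSeries r u)]
  · simp [truncateSeries]
  · intro j hj
    simp [truncateSeries, hj]

end Truncate

section StarProduct

variable {n : ℕ} {M : Type*} [TopologicalSpace M] [ChartedSpace (EuclideanSpace ℝ (Fin n)) M]
  {P : PoissonStructure n M}

theorem StarProduct.bracket_eq (s : StarProduct P) (f g : SmoothFun n M) (x : M) :
    P.bracket f g x = -Complex.I * (s.C 1 f g x - s.C 1 g f x) := by
  rw [← SmoothFun.sub_apply, s.C_one, SmoothFun.smul_apply, ← mul_assoc, neg_mul, Complex.I_mul_I,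
    neg_neg, one_mul]

/-- The bound has to be uniform in `g`: it will bound the commutators of one operator with all
functions `g` at once. -/
theorem StarProduct.exists_hasOrderLTOn (s : StarProduct P) (p : M) (N : ℕ) :
    ∃ (V : Set M) (m : ℕ), IsOpen V ∧ p ∈ V ∧
      ∀ r < N, ∀ g, HasOrderLTOn V m ((s.C r).flip g) := by
  induction N with
  | zero => exact ⟨Set.univ, 0, isOpen_univ, trivial, fun r hr => absurd hr (Nat.not_lt_zero r)⟩
  | succ N ih =>
    obtain ⟨V, m, hV, hpV, h⟩ := ih
    obtain ⟨V', hV', hpV', k, -, h'⟩ := s.bidifferential N p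
    refine ⟨V ∩ V', max m (k + 1), hV.inter hV', ⟨hpV, hpV'⟩, fun r hr g => ?_⟩
    rcases Nat.lt_succ_iff_lt_or_eq.1 hr with hr | rfl
    · exact (h r hr g).mono Set.inter_subset_left (le_max_left _ _)
    · exact (hasOrderLEOn_iff.1 (h' g)).mono Set.inter_subset_right (le_max_right _ _)

end StarProduct

/-! ### Locality, multiplicativity and differentiability of the series -/

section LocalIsomorphism

variable {n : ℕ} {M : Type*} [TopologicalSpace M] [ChartedSpace (EuclideanSpace ℝ (Fin n)) M]
  [IsManifold (𝓡 n) ∞ M] [T2Space M] {P P' : PoissonStructure n M}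
  {s : StarProduct P} {s' : StarProduct P'}
  {T : ℕ → SmoothFun n M →ₗ[ℂ] SmoothFun n M} {b : ℕ → SmoothFun n M} {W : Set M}

/-- For a bump function χ supported where f vanishes, the product f ⋆' b ⋆' χ is zero on all of M,
whatever `b` is. Hence T(f) ⋆ T(χ) = 0, and T(χ) can be cancelled where its leading term χ is 1. -/
theorem isLocalOn_of_middle_mul (hT0 : ∀ f, ∀ x ∈ W, T 0 f x = f x)
    (hT : ∀ a a', formalApply T (formalMul s'.C (formalMul s'.C a b) a') =
        formalMul s.C (formalApply T a) (formalApply T a')) (r : ℕ) : IsLocalOn W (T r) := by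
  intro V hVW hV f hf q hq
  obtain ⟨χ, N, hN, hqN, hNV, h1, hχ⟩ := SmoothFun.exists_bump (n := n) hV hq
  have hzero : formalMul s'.C (formalMul s'.C (constSeries f) b) (constSeries χ) = 0 := by
    have hleft : AgreeOn V (constSeries f) 0 := by
      intro m x hx
      cases m with
      | zero => exact hf x hx
      | succ m => rfl
    have hright : AgreeOn (closure (Function.support χ))ᶜ (constSeries χ) 0 := by
      intro m x hx
      cases m with
      | zero => exact Function.notMem_support.1 fun h => hx (subset_closure h)
      | succ m => rfl
    have h2 := s'.agreeOn_formalMul hV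
      (s'.agreeOn_formalMul hV hleft (fun _ _ _ => rfl : AgreeOn V b b))
      (fun _ _ _ => rfl : AgreeOn V (constSeries χ) (constSeries χ))
    rw [formalMul_zero_left, formalMul_zero_left] at h2
    have h3 := s'.agreeOn_formalMul isClosed_closure.isOpen_compl
      (fun _ _ _ => rfl : AgreeOn _ (formalMul s'.C (constSeries f) b) _) hright
    rw [formalMul_zero_right] at h3
    funext m
    refine ContMDiffMap.ext fun x => ?_
    by_cases hx : x ∈ V
    · exact h2 m x hx
    · exact h3 m x fun h => hx (hχ h)
  have hmul := hT (constSeries f) (constSeries χ)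
  have hT00 : formalApply T 0 = 0 := by
    funext m
    simp [formalApply]
  rw [hzero, hT00] at hmul
  have hTf : AgreeOn N (formalApply T (constSeries f)) 0 := by
    refine s.agreeOn_zero_of_mul hN (v := formalApply T (constSeries χ)) (fun x hx => ?_)
      (fun m x _ => by rw [← hmul])
    rw [formalApply_constSeries, hT0 χ x (hVW (hNV hx)), h1 x hx]
    exact one_ne_zero
  have := hTf r q hqN
  rwa [formalApply_constSeries] at this

/-- The middle factor is the unit, so that the formal series is multiplicative. -/
theorem agreeOn_formalApply_formalMul (hW : IsOpen W) (hT0 : ∀ f, ∀ x ∈ W, T 0 f x = f x)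
    (hT1 : AgreeOn W (formalApply T (constSeries 1)) (constSeries 1))
    (hT : ∀ a a', formalApply T (formalMul s'.C (formalMul s'.C a b) a') =
        formalMul s.C (formalApply T a) (formalApply T a')) (a a' : ℕ → SmoothFun n M) :
    AgreeOn W (formalApply T (formalMul s'.C a a'))
      (formalMul s.C (formalApply T a) (formalApply T a')) := by
  have hloc := isLocalOn_of_middle_mul hT0 hT
  -- With both arguments 1 the hypothesis reads T(b) = T(1) ⋆ T(1), which is 1 and thus T(1) on `W`;
  -- locality makes T injective there.
  have hb : AgreeOn W b (constSeries 1) := by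
    refine AgreeOn.of_formalApply hW hloc hT0 (AgreeOn.trans ?_ hT1.symm)
    have h1 := hT (constSeries 1) (constSeries 1)
    rw [s'.one_star, s'.star_one] at h1
    rw [h1]
    have h2 := s.agreeOn_formalMul hW hT1 hT1
    rwa [s.one_star] at h2
  have h3 := s'.agreeOn_formalMul hW (s'.agreeOn_formalMul hW
    (fun _ _ _ => rfl : AgreeOn W a a) hb) (fun _ _ _ => rfl : AgreeOn W a' a')
  rw [s'.star_one] at h3
  have h4 := agreeOn_formalApply hloc subset_rfl hW h3.symm
  rw [hT] at h4
  exact h4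

/-- The first order of a multiplicative formal series shows that the brackets agree. -/
theorem bracket_eq_of_agreeOn (hT0 : ∀ f, ∀ x ∈ W, T 0 f x = f x) (hW : IsOpen W)
    (hT : ∀ a a', AgreeOn W (formalApply T (formalMul s'.C a a'))
      (formalMul s.C (formalApply T a) (formalApply T a'))) (f g : SmoothFun n M) :
    ∀ x ∈ W, P.bracket f g x = P'.bracket f g x := by
  intro x hx
  have key (f g : SmoothFun n M) :
      s'.C 1 f g x + T 1 (f * g) x = s.C 1 f g x + (T 1 f x * g x + f x * T 1 g x) := by
    have h1 := hT (constSeries f) (constSeries g) 1 x hx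
    have h2 : s.C 1 (T 0 f) (T 0 g) x = s.C 1 f g x :=
      ((s.isLocalOn_left 1 (T 0 g)).congr (Set.subset_univ W) hW (hT0 f) x hx).trans
        ((s.isLocalOn_right 1 f).congr (Set.subset_univ W) hW (hT0 g) x hx)
    have e1 : formalApply T (formalMul s'.C (constSeries f) (constSeries g)) 1 =
        T 0 (s'.C 1 f g) + T 1 (f * g) := by
      simp [formalApply, Finset.Nat.antidiagonal_succ, formalMul_constSeries, s'.C_zero]
    have e2 : formalMul s.C (formalApply T (constSeries f)) (formalApply T (constSeries g)) 1 =
        T 0 f * T 1 g + T 1 f * T 0 g + s.C 1 (T 0 f) (T 0 g) := by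
      simp [formalMul, Finset.Nat.antidiagonal_succ, formalApply_constSeries, s.C_zero]
    rw [e1, e2] at h1
    simp only [SmoothFun.add_apply, SmoothFun.mul_apply, hT0 _ x hx, h2] at h1
    rw [h1]
    ring
  -- Apart from the two `C 1` terms, `key` is symmetric in `f` and `g`, so the difference of both
  -- instances compares the antisymmetric parts.
  have h1 := key f g
  have h2 := key g f
  rw [mul_comm g f] at h2
  rw [s.bracket_eq, s'.bracket_eq]
  linear_combination Complex.I * (h1 - h2)

/-- The coefficients of a multiplicative formal series starting with the identity are
differential operators. -/
theorem exists_hasOrderLTOn_of_agreeOn (hW : IsOpen W) (hT0 : ∀ f, ∀ x ∈ W, T 0 f x = f x)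
    (hT : ∀ a a', AgreeOn W (formalApply T (formalMul s'.C a a'))
      (formalMul s.C (formalApply T a) (formalApply T a'))) {p : M} (hp : p ∈ W) (N : ℕ) :
    ∃ (V : Set M) (m : ℕ), IsOpen V ∧ p ∈ V ∧ V ⊆ W ∧ ∀ r < N, HasOrderLTOn V m (T r) := by
  induction N with
  | zero => exact ⟨W, 0, hW, hp, subset_rfl, fun r hr => absurd hr (Nat.not_lt_zero r)⟩
  | succ N ih =>
    obtain ⟨V₁, m₁, hV₁, hp₁, hVW, h₁⟩ := ih
    obtain ⟨V₂, m₂, hV₂, hp₂, h₂⟩ := s.exists_hasOrderLTOn p (N + 1)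
    obtain ⟨V₃, m₃, hV₃, hp₃, h₃⟩ := s'.exists_hasOrderLTOn p (N + 1)
    let V := V₁ ∩ (V₂ ∩ V₃)
    have hV : IsOpen V := hV₁.inter (hV₂.inter hV₃)
    have hT' (j : ℕ) : HasOrderLTOn V m₁ (truncateSeries N T j) := by
      by_cases hj : j < N
      · rw [truncateSeries, if_pos hj]
        exact (h₁ j hj).mono Set.inter_subset_left le_rfl
      · rw [truncateSeries, if_neg hj]
        exact HasOrderLTOn.of_eq_zero (fun _ _ _ => rfl) _
    -- In order N, T(f ⋆' g) = T(f) ⋆ T(g) reads -D₁ f + T_N(f g) = D₂ f + (T_N f) g. So the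
    -- commutator of T_N with g is D₁ + D₂, built from T_r with r < N and the star products; the
    -- sign of D₁ is absorbed in `-g`.
    have hTN : HasOrderLTOn V (m₁ + m₂ + m₃ + 1) (T N) := by
      intro g
      let D₁ : SmoothFun n M →ₗ[ℂ] SmoothFun n M :=
        ∑ p ∈ Finset.HasAntidiagonal.antidiagonal N,
          truncateSeries N T p.1 ∘ₗ (s'.C p.2).flip (-g)
      let D₂ : SmoothFun n M →ₗ[ℂ] SmoothFun n M :=
        ∑ p ∈ Finset.HasAntidiagonal.antidiagonal N,
          ∑ q ∈ Finset.HasAntidiagonal.antidiagonal p.2,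
            (s.C p.1).flip (T q.2 g) ∘ₗ truncateSeries N T q.1
      have hD₁ : HasOrderLTOn V (m₁ + m₂ + m₃) D₁ := by
        refine HasOrderLTOn.sum _ fun q hq => ?_
        have hq2 : q.1 + q.2 = N := Finset.HasAntidiagonal.mem_antidiagonal.1 hq
        exact ((hT' q.1).comp hV ((h₃ q.2 (by omega) (-g)).mono
          (Set.inter_subset_right.trans Set.inter_subset_right) le_rfl)).mono
          subset_rfl (by omega)
      have hD₂ : HasOrderLTOn V (m₁ + m₂ + m₃) D₂ := by
        refine HasOrderLTOn.sum _ fun q hq => HasOrderLTOn.sum _ fun q' _ => ?_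
        have hq2 : q.1 + q.2 = N := Finset.HasAntidiagonal.mem_antidiagonal.1 hq
        exact (((h₂ q.1 (by omega) (T q'.2 g)).mono
          (Set.inter_subset_right.trans Set.inter_subset_left) le_rfl).comp hV (hT' q'.1)).mono
          subset_rfl (by omega)
      refine (hD₁.add hD₂).congr fun f x hx => ?_
      have hxW : x ∈ W := hVW hx.1
      have h4 := hT (constSeries f) (constSeries g) N x hxW
      rw [formalApply_eq_truncateSeries, formalMul_eq_truncateSeries s.C] at h4
      have e1 : formalApply (truncateSeries N T) (formalMul s'.C (constSeries f) (constSeries g)) N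
          = -D₁ f := by
        simp [formalApply, D₁, formalMul_constSeries]
      have e2 : formalMul s.C (truncateSeries N (formalApply T (constSeries f)))
          (formalApply T (constSeries g)) N = D₂ f := by
        simp only [formalMul, D₂, LinearMap.sum_apply, LinearMap.comp_apply, LinearMap.flip_apply,
          formalApply_constSeries]
        refine Finset.sum_congr rfl fun q _ => Finset.sum_congr rfl fun q' _ => ?_
        by_cases hj : q'.1 < N
        · simp [truncateSeries, hj, formalApply_constSeries]
        · simp [truncateSeries, hj]
      rw [e1, e2, formalMul_at_zero, formalApply_constSeries, formalApply_constSeries,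
        constSeries_zero, constSeries_zero, s.C_zero, s'.C_zero, SmoothFun.add_apply,
        SmoothFun.add_apply, SmoothFun.mul_apply, hT0 g x hxW, SmoothFun.neg_apply] at h4
      rw [mulCommutator_apply, SmoothFun.sub_apply, SmoothFun.mul_apply, mul_comm g f,
        LinearMap.add_apply, SmoothFun.add_apply]
      linear_combination h4
    refine ⟨V, m₁ + m₂ + m₃ + 1, hV, ⟨hp₁, hp₂, hp₃⟩, Set.inter_subset_left.trans hVW,
      fun r hr => ?_⟩
    rcases Nat.lt_succ_iff_lt_or_eq.1 hr with hr | rfl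
    · exact (h₁ r hr).mono Set.inter_subset_left (by omega)
    · exact hTN

end LocalIsomorphism

/-! ### Restriction of local operators to open subsets -/

section Restrict

variable {n : ℕ} {M : Type*} [TopologicalSpace M] [ChartedSpace (EuclideanSpace ℝ (Fin n)) M]

/-- A smooth function on `U` agrees with one on `M` on the subset `W`. -/
def Extends {U : Opens M} (W : Set M) (u : SmoothFun n U) (F : SmoothFun n M) : Prop :=
  ∀ x : U, (x : M) ∈ W → u x = F x

theorem Extends.mono {U : Opens M} {V W : Set M} (hWV : W ⊆ V) {u : SmoothFun n U}
    {F : SmoothFun n M} (h : Extends V u F) : Extends W u F :=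
  fun x hx => h x (hWV hx)

theorem extends_restrict (U : Opens M) (W : Set M) (F : SmoothFun n M) :
    Extends W (F.restrict U) F :=
  fun _ _ => rfl

theorem IsLocalOn.mono {V W : Set M} (hWV : W ⊆ V) {D : SmoothFun n M →ₗ[ℂ] SmoothFun n M}
    (hD : IsLocalOn V D) : IsLocalOn W D :=
  fun W' hW' => hD W' (hW'.trans hWV)

theorem extends_constSeries_one (U : Opens M) (W : Set M) (r : ℕ) :
    Extends W ((constSeries 1 : ℕ → SmoothFun n U) r) ((constSeries 1 : ℕ → SmoothFun n M) r) := by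
  intro x _
  cases r <;> rfl

theorem SmoothFun.contMDiff_of_germs {U : Opens M} {v : U → ℂ}
    (h : ∀ q : U, ∃ (F : SmoothFun n M) (W : Set M), IsOpen W ∧ (q : M) ∈ W ∧
      ∀ x : U, (x : M) ∈ W → v x = F x) : ContMDiff (𝓡 n) 𝓘(ℝ, ℂ) ∞ v := by
  intro q
  obtain ⟨F, W, hW, hqW, hF⟩ := h q
  have h1 : ContMDiffAt (𝓡 n) 𝓘(ℝ, ℂ) ∞ (F.restrict U) q := (F.restrict U).contMDiff.contMDiffAt
  refine h1.congr_of_eventuallyEq ?_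
  filter_upwards [(hW.preimage continuous_subtype_val).mem_nhds hqW] with x hx
  exact hF x hx

/-- A commutator with a function on `U` corresponds to one with an extension of its germ. The
neighbourhood `N` shrinks with every commutator, hence the order is tested at a single point. -/
theorem HasOrderLTOn.of_extends [IsManifold (𝓡 n) ∞ M] [T2Space M] {U : Opens M}
    {q : U} {m : ℕ} {D : SmoothFun n M →ₗ[ℂ] SmoothFun n M}
    {D' : SmoothFun n U →ₗ[ℂ] SmoothFun n U} {N : Set M} (hN : IsOpen N) (hq : (q : M) ∈ N)
    (h : ∀ W ⊆ N, IsOpen W → ∀ u F, Extends W u F → Extends W (D' u) (D F))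
    (hD : HasOrderLTOn {(q : M)} m D) : HasOrderLTOn {q} m D' := by
  induction m generalizing D D' N with
  | zero =>
    rintro f x rfl
    obtain ⟨F, W, hW, hxW, -, hF⟩ := SmoothFun.exists_extension (n := n) U x
    have h1 := h (N ∩ W) Set.inter_subset_left (hN.inter hW) f (F f)
      (fun y hy => (hF f y hy.2).symm) x ⟨hq, hxW⟩
    rw [h1]
    exact hD _ _ rfl
  | succ m ih =>
    intro a
    obtain ⟨F, W, hW, hxW, -, hF⟩ := SmoothFun.exists_extension (n := n) U q
    refine ih (D := mulCommutator D (F a)) (hN.inter hW) ⟨hq, hxW⟩ ?_ (hD (F a))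
    intro W' hW'N hW' u G huG x hx
    have ha : F a x = a x := hF a x (hW'N hx).2
    have h1 := h W' (hW'N.trans Set.inter_subset_left) hW' (a * u) (F a * G)
      (fun y hy => by
        rw [SmoothFun.mul_apply, SmoothFun.mul_apply, huG y hy, hF a y (hW'N hy).2]) x hx
    have h2 := h W' (hW'N.trans Set.inter_subset_left) hW' u G huG x hx
    rw [mulCommutator_apply, mulCommutator_apply, SmoothFun.sub_apply, SmoothFun.sub_apply,
      SmoothFun.mul_apply, SmoothFun.mul_apply, h1, h2, ha]

variable [IsManifold (𝓡 n) ∞ M] [T2Space M] (U : Opens M)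

/-- A linear extension of germs at `q`. -/
noncomputable def SmoothFun.extendGerm (q : U) : SmoothFun n U →ₗ[ℂ] SmoothFun n M :=
  (SmoothFun.exists_extension (n := n) U q).choose

theorem SmoothFun.extendGerm_spec (q : U) : ∃ W : Set M, IsOpen W ∧ (q : M) ∈ W ∧ W ⊆ U ∧
    ∀ f : SmoothFun n U, Extends W f (SmoothFun.extendGerm U q f) := by
  obtain ⟨W, hW, hqW, hWU, h⟩ := (SmoothFun.exists_extension (n := n) U q).choose_spec
  exact ⟨W, hW, hqW, hWU, fun f x hx => (h f x hx).symm⟩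

variable {U}

/-- The restricted operator will be defined at each point by a separate choice of extensions. By
locality the choice is immaterial, which gives smoothness and transfers identities from `M`. -/
theorem germ_bilinear_eq {C : SmoothFun n M →ₗ[ℂ] SmoothFun n M →ₗ[ℂ] SmoothFun n M}
    (hl : ∀ g, IsLocalOn U (C.flip g)) (hr : ∀ f, IsLocalOn U (C f)) {W : Set M}
    (hW : IsOpen W) {u v : SmoothFun n U} {F G : SmoothFun n M} (hu : Extends W u F)
    (hv : Extends W v G) (x : U) (hx : (x : M) ∈ W) :
    C (SmoothFun.extendGerm U x u) (SmoothFun.extendGerm U x v) x = C F G x := by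
  obtain ⟨N, hN, hxN, hNU, h⟩ := SmoothFun.extendGerm_spec (n := n) U x
  have hNW : N ∩ W ⊆ U := Set.inter_subset_left.trans hNU
  refine ((hl _).congr hNW (hN.inter hW)
    (fun y hy => ((h u ⟨y, hNU hy.1⟩ hy.1).symm.trans (hu ⟨y, hNU hy.1⟩ hy.2))) x ⟨hxN, hx⟩).trans
    ((hr F).congr hNW (hN.inter hW)
    (fun y hy => ((h v ⟨y, hNU hy.1⟩ hy.1).symm.trans (hv ⟨y, hNU hy.1⟩ hy.2))) x ⟨hxN, hx⟩)

/-- The value of the restriction of a local bilinear operator to an open subset. -/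
noncomputable def restrictBilinearFun
    (C : SmoothFun n M →ₗ[ℂ] SmoothFun n M →ₗ[ℂ] SmoothFun n M)
    (hl : ∀ g, IsLocalOn U (C.flip g)) (hr : ∀ f, IsLocalOn U (C f)) (u v : SmoothFun n U) :
    SmoothFun n U :=
  ⟨fun x => C (SmoothFun.extendGerm U x u) (SmoothFun.extendGerm U x v) x,
    SmoothFun.contMDiff_of_germs fun q => by
      obtain ⟨W, hW, hqW, -, h⟩ := SmoothFun.extendGerm_spec (n := n) U q
      exact ⟨_, W, hW, hqW, fun x hx => germ_bilinear_eq hl hr hW (h u) (h v) x hx⟩⟩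

theorem restrictBilinearFun_apply (C : SmoothFun n M →ₗ[ℂ] SmoothFun n M →ₗ[ℂ] SmoothFun n M)
    (hl : ∀ g, IsLocalOn U (C.flip g)) (hr : ∀ f, IsLocalOn U (C f)) (u v : SmoothFun n U)
    (x : U) : restrictBilinearFun C hl hr u v x =
      C (SmoothFun.extendGerm U x u) (SmoothFun.extendGerm U x v) x := rfl

/-- The restriction of a local bilinear operator to an open subset. -/
noncomputable def restrictBilinear (C : SmoothFun n M →ₗ[ℂ] SmoothFun n M →ₗ[ℂ] SmoothFun n M)
    (hl : ∀ g, IsLocalOn U (C.flip g)) (hr : ∀ f, IsLocalOn U (C f)) :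
    SmoothFun n U →ₗ[ℂ] SmoothFun n U →ₗ[ℂ] SmoothFun n U :=
  LinearMap.mk₂ ℂ (restrictBilinearFun C hl hr)
    (fun u u' v => ContMDiffMap.ext fun x => by
      simp only [SmoothFun.add_apply, restrictBilinearFun_apply, map_add, LinearMap.add_apply])
    (fun c u v => ContMDiffMap.ext fun x => by
      simp only [SmoothFun.smul_apply, restrictBilinearFun_apply, map_smul, LinearMap.smul_apply])
    (fun u v v' => ContMDiffMap.ext fun x => by
      simp only [SmoothFun.add_apply, restrictBilinearFun_apply, map_add])
    (fun c u v => ContMDiffMap.ext fun x => by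
      simp only [SmoothFun.smul_apply, restrictBilinearFun_apply, map_smul])

section Bilinear

variable {C : SmoothFun n M →ₗ[ℂ] SmoothFun n M →ₗ[ℂ] SmoothFun n M}
    (hl : ∀ g, IsLocalOn U (C.flip g)) (hr : ∀ f, IsLocalOn U (C f))

theorem extends_restrictBilinear {W : Set M}
    (hW : IsOpen W) {u v : SmoothFun n U} {F G : SmoothFun n M} (hu : Extends W u F)
    (hv : Extends W v G) : Extends W (restrictBilinear C hl hr u v) (C F G) :=
  germ_bilinear_eq hl hr hW hu hv

theorem restrictBilinear_restrict (F G : SmoothFun n M) :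
    restrictBilinear C hl hr (F.restrict U) (G.restrict U) = (C F G).restrict U :=
  ContMDiffMap.ext fun x => extends_restrictBilinear hl hr isOpen_univ
    (extends_restrict U _ F) (extends_restrict U _ G) x trivial

/-- The order bound of `C` is uniform in the other argument, so it survives replacing that argument
by an extension which varies with the point. -/
theorem IsBidifferentialOperator.restrictBilinear (hC : IsBidifferentialOperator C) :
    IsBidifferentialOperator (restrictBilinear C hl hr) := by
  intro p
  obtain ⟨V, hV, hpV, k, h1, h2⟩ := hC p
  refine ⟨Subtype.val ⁻¹' V, hV.preimage continuous_subtype_val, hpV, k, fun u => ?_, fun v => ?_⟩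
  · refine hasOrderLEOn_iff.2 (HasOrderLTOn.of_forall_singleton fun q hq => ?_)
    obtain ⟨W, hW, hqW, -, h⟩ := SmoothFun.extendGerm_spec (n := n) U q
    refine HasOrderLTOn.of_extends hW hqW (fun W' hW'W hW' v G hv => ?_)
      ((hasOrderLEOn_iff.1 (h1 (SmoothFun.extendGerm U q u))).mono
        (Set.singleton_subset_iff.2 hq : {(q : M)} ⊆ V) le_rfl)
    exact extends_restrictBilinear hl hr hW' ((h u).mono hW'W) hv
  · refine hasOrderLEOn_iff.2 (HasOrderLTOn.of_forall_singleton fun q hq => ?_)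
    obtain ⟨W, hW, hqW, -, h⟩ := SmoothFun.extendGerm_spec (n := n) U q
    refine HasOrderLTOn.of_extends hW hqW (fun W' hW'W hW' u F hu => ?_)
      ((hasOrderLEOn_iff.1 (h2 (SmoothFun.extendGerm U q v))).mono
        (Set.singleton_subset_iff.2 hq : {(q : M)} ⊆ V) le_rfl)
    exact extends_restrictBilinear hl hr hW' hu ((h v).mono hW'W)

end Bilinear

theorem germ_linear_eq {D : SmoothFun n M →ₗ[ℂ] SmoothFun n M} (hD : IsLocalOn U D) {W : Set M}
    (hW : IsOpen W) {u : SmoothFun n U} {F : SmoothFun n M} (hu : Extends W u F)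
    (x : U) (hx : (x : M) ∈ W) : D (SmoothFun.extendGerm U x u) x = D F x := by
  obtain ⟨N, hN, hxN, hNU, h⟩ := SmoothFun.extendGerm_spec (n := n) U x
  exact hD.congr (Set.inter_subset_left.trans hNU) (hN.inter hW)
    (fun y hy => ((h u ⟨y, hNU hy.1⟩ hy.1).symm.trans (hu ⟨y, hNU hy.1⟩ hy.2))) x ⟨hxN, hx⟩

/-- The value of the restriction of a local linear operator to an open subset. -/
noncomputable def restrictLinearFun (D : SmoothFun n M →ₗ[ℂ] SmoothFun n M) (hD : IsLocalOn U D)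
    (u : SmoothFun n U) : SmoothFun n U :=
  ⟨fun x => D (SmoothFun.extendGerm U x u) x,
    SmoothFun.contMDiff_of_germs fun q => by
      obtain ⟨W, hW, hqW, -, h⟩ := SmoothFun.extendGerm_spec (n := n) U q
      exact ⟨_, W, hW, hqW, fun x hx => germ_linear_eq hD hW (h u) x hx⟩⟩

theorem restrictLinearFun_apply (D : SmoothFun n M →ₗ[ℂ] SmoothFun n M) (hD : IsLocalOn U D)
    (u : SmoothFun n U) (x : U) :
    restrictLinearFun D hD u x = D (SmoothFun.extendGerm U x u) x := rfl

/-- The restriction of a local linear operator to an open subset. -/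
noncomputable def restrictLinear (D : SmoothFun n M →ₗ[ℂ] SmoothFun n M) (hD : IsLocalOn U D) :
    SmoothFun n U →ₗ[ℂ] SmoothFun n U where
  toFun := restrictLinearFun D hD
  map_add' u u' := ContMDiffMap.ext fun x => by
    simp only [SmoothFun.add_apply, restrictLinearFun_apply, map_add]
  map_smul' c u := ContMDiffMap.ext fun x => by
    simp only [SmoothFun.smul_apply, restrictLinearFun_apply, map_smul, RingHom.id_apply]

theorem extends_restrictLinear {D : SmoothFun n M →ₗ[ℂ] SmoothFun n M} (hD : IsLocalOn U D)
    {W : Set M} (hW : IsOpen W) {u : SmoothFun n U} {F : SmoothFun n M} (hu : Extends W u F) :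
    Extends W (restrictLinear D hD u) (D F) :=
  germ_linear_eq hD hW hu

theorem isDifferentialOperator_restrictLinear {D : SmoothFun n M →ₗ[ℂ] SmoothFun n M}
    (hD : IsLocalOn U D)
    (h : ∀ p ∈ U, ∃ (V : Set M) (m : ℕ), IsOpen V ∧ p ∈ V ∧ HasOrderLTOn V m D) :
    IsDifferentialOperator (restrictLinear D hD) := by
  intro p
  obtain ⟨V, m, hV, hpV, hm⟩ := h p p.2
  refine ⟨Subtype.val ⁻¹' V, hV.preimage continuous_subtype_val, hpV, m,
    hasOrderLEOn_iff.2 (HasOrderLTOn.of_forall_singleton fun q hq => ?_)⟩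
  exact HasOrderLTOn.of_extends hV hq (fun W _ hW u F hu => extends_restrictLinear hD hW hu)
    (hm.mono (Set.singleton_subset_iff.2 hq : {(q : M)} ⊆ V) m.le_succ)

theorem Extends.formalMul {C : ℕ → SmoothFun n M →ₗ[ℂ] SmoothFun n M →ₗ[ℂ] SmoothFun n M}
    (hl : ∀ r g, IsLocalOn U ((C r).flip g)) (hr : ∀ r f, IsLocalOn U (C r f)) {W : Set M}
    (hW : IsOpen W) {u v : ℕ → SmoothFun n U} {F G : ℕ → SmoothFun n M}
    (hu : ∀ r, Extends W (u r) (F r)) (hv : ∀ r, Extends W (v r) (G r)) (m : ℕ) :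
    Extends W (formalMul (fun r => restrictBilinear (C r) (hl r) (hr r)) u v m)
      (DeformationQuantization.formalMul C F G m) := by
  intro x hx
  simp only [DeformationQuantization.formalMul, SmoothFun.sum_apply]
  exact Finset.sum_congr rfl fun p _ => Finset.sum_congr rfl fun q _ =>
    extends_restrictBilinear (hl p.1) (hr p.1) hW (hu q.1) (hv q.2) x hx

theorem Extends.formalApply {T : ℕ → SmoothFun n M →ₗ[ℂ] SmoothFun n M}
    (hT : ∀ r, IsLocalOn U (T r)) {W : Set M} (hW : IsOpen W) {u : ℕ → SmoothFun n U}
    {F : ℕ → SmoothFun n M} (hu : ∀ r, Extends W (u r) (F r)) (m : ℕ) :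
    Extends W (formalApply (fun r => restrictLinear (T r) (hT r)) u m)
      (DeformationQuantization.formalApply T F m) := by
  intro x hx
  simp only [DeformationQuantization.formalApply, SmoothFun.sum_apply]
  exact Finset.sum_congr rfl fun p _ => extends_restrictLinear (hT p.1) hW (hu p.2) x hx

end Restrict

/-! ### Restriction of Poisson structures and star products -/

section RestrictStructures

variable {n : ℕ} {M : Type*} [TopologicalSpace M] [ChartedSpace (EuclideanSpace ℝ (Fin n)) M]
  [IsManifold (𝓡 n) ∞ M] [T2Space M]

/-- If g = a g with a and g zero at x, then {f, g} = {f, a} g + a {f, g} vanishes at x. -/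
theorem PoissonStructure.isLocalOn (P : PoissonStructure n M) (f : SmoothFun n M) (V : Set M) :
    IsLocalOn V (P.bracket f) := by
  intro W _ hW g hg x hx
  obtain ⟨a, hag, ha⟩ := SmoothFun.exists_mul_eq_self hW hx hg
  rw [← hag, P.leibniz, SmoothFun.add_apply, SmoothFun.mul_apply, SmoothFun.mul_apply, hg x hx, ha,
    mul_zero, zero_mul, add_zero]

theorem PoissonStructure.isLocalOn_flip (P : PoissonStructure n M) (g : SmoothFun n M)
    (V : Set M) : IsLocalOn V (P.bracket.flip g) := by
  intro W hWV hW f hf x hx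
  rw [LinearMap.flip_apply, P.antisymm, SmoothFun.neg_apply,
    P.isLocalOn g V W hWV hW f hf x hx, neg_zero]

/-- The restriction of a Poisson structure to an open subset. -/
noncomputable def PoissonStructure.restrict (P : PoissonStructure n M) (U : Opens M) :
    PoissonStructure n U where
  bracket := restrictBilinear P.bracket (fun g => P.isLocalOn_flip g U) (fun f => P.isLocalOn f U)
  antisymm f g := ContMDiffMap.ext fun x => by
    obtain ⟨W, hW, hxW, -, h⟩ := SmoothFun.extendGerm_spec (n := n) U x
    rw [SmoothFun.neg_apply, extends_restrictBilinear _ _ hW (h f) (h g) x hxW,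
      extends_restrictBilinear _ _ hW (h g) (h f) x hxW, P.antisymm, SmoothFun.neg_apply]
  jacobi f g k := ContMDiffMap.ext fun x => by
    obtain ⟨W, hW, hxW, -, h⟩ := SmoothFun.extendGerm_spec (n := n) U x
    have key (a b c : SmoothFun n U) :=
      extends_restrictBilinear (fun g => P.isLocalOn_flip g U) (fun f => P.isLocalOn f U) hW (h a)
        (extends_restrictBilinear (fun g => P.isLocalOn_flip g U) (fun f => P.isLocalOn f U) hW
          (h b) (h c)) x hxW
    rw [SmoothFun.add_apply, SmoothFun.add_apply, key, key, key, ← SmoothFun.add_apply,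
      ← SmoothFun.add_apply, P.jacobi]
    rfl
  leibniz f g k := ContMDiffMap.ext fun x => by
    obtain ⟨W, hW, hxW, -, h⟩ := SmoothFun.extendGerm_spec (n := n) U x
    have hgk : Extends W (g * k) (SmoothFun.extendGerm U x g * SmoothFun.extendGerm U x k) :=
      fun y hy => by rw [SmoothFun.mul_apply, SmoothFun.mul_apply, h g y hy, h k y hy]
    rw [extends_restrictBilinear _ _ hW (h f) hgk x hxW, P.leibniz, SmoothFun.add_apply,
      SmoothFun.add_apply, SmoothFun.mul_apply, SmoothFun.mul_apply, SmoothFun.mul_apply,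
      SmoothFun.mul_apply, extends_restrictBilinear _ _ hW (h f) (h g) x hxW,
      extends_restrictBilinear _ _ hW (h f) (h k) x hxW, h g x hxW, h k x hxW]
  real f g := ContMDiffMap.ext fun x => by
    obtain ⟨W, hW, hxW, -, h⟩ := SmoothFun.extendGerm_spec (n := n) U x
    have hconj (a : SmoothFun n U) : Extends W a.conj (SmoothFun.extendGerm U x a).conj :=
      fun y hy => by rw [SmoothFun.conj_apply, SmoothFun.conj_apply, h a y hy]
    rw [SmoothFun.conj_apply, extends_restrictBilinear _ _ hW (h f) (h g) x hxW,
      extends_restrictBilinear _ _ hW (hconj f) (hconj g) x hxW, ← P.real, SmoothFun.conj_apply]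

theorem PoissonStructure.extends_bracket (P : PoissonStructure n M) {U : Opens M} {W : Set M}
    (hW : IsOpen W) {u v : SmoothFun n U} {F G : SmoothFun n M} (hu : Extends W u F)
    (hv : Extends W v G) : Extends W ((P.restrict U).bracket u v) (P.bracket F G) :=
  extends_restrictBilinear (fun g => P.isLocalOn_flip g U) (fun f => P.isLocalOn f U) hW hu hv

variable {P P' : PoissonStructure n M}

/-- The restriction of a star product to an open subset. -/
noncomputable def StarProduct.restrict (s : StarProduct P) (U : Opens M) :
    StarProduct (P.restrict U) where
  C r := restrictBilinear (s.C r) (fun g => (s.isLocalOn_left r g).mono (Set.subset_univ _))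
    (fun f => (s.isLocalOn_right r f).mono (Set.subset_univ _))
  bidifferential r := (s.bidifferential r).restrictBilinear _ _
  assoc f g k := by
    funext m
    refine ContMDiffMap.ext fun x => ?_
    obtain ⟨W, hW, hxW, -, h⟩ := SmoothFun.extendGerm_spec (n := n) U x
    rw [Extends.formalMul _ _ hW (Extends.formalMul _ _ hW (fun r => h (f r)) (fun r => h (g r)))
      (fun r => h (k r)) m x hxW, Extends.formalMul _ _ hW (fun r => h (f r))
      (Extends.formalMul _ _ hW (fun r => h (g r)) (fun r => h (k r))) m x hxW, s.assoc]
  C_zero f g := ContMDiffMap.ext fun x => by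
    obtain ⟨W, hW, hxW, -, h⟩ := SmoothFun.extendGerm_spec (n := n) U x
    rw [extends_restrictBilinear _ _ hW (h f) (h g) x hxW, s.C_zero, SmoothFun.mul_apply,
      SmoothFun.mul_apply, h f x hxW, h g x hxW]
  C_one f g := ContMDiffMap.ext fun x => by
    obtain ⟨W, hW, hxW, -, h⟩ := SmoothFun.extendGerm_spec (n := n) U x
    rw [SmoothFun.sub_apply, SmoothFun.smul_apply,
      extends_restrictBilinear _ _ hW (h f) (h g) x hxW,
      extends_restrictBilinear _ _ hW (h g) (h f) x hxW, ← SmoothFun.sub_apply, s.C_one,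
      SmoothFun.smul_apply]
    exact congrArg (Complex.I * ·) (P.extends_bracket hW (h f) (h g) x hxW).symm
  one_star f := by
    funext m
    refine ContMDiffMap.ext fun x => ?_
    obtain ⟨W, hW, hxW, -, h⟩ := SmoothFun.extendGerm_spec (n := n) U x
    rw [Extends.formalMul _ _ hW (extends_constSeries_one U W) (fun r => h (f r)) m x hxW,
      s.one_star, h (f m) x hxW]
  star_one f := by
    funext m
    refine ContMDiffMap.ext fun x => ?_
    obtain ⟨W, hW, hxW, -, h⟩ := SmoothFun.extendGerm_spec (n := n) U x
    rw [Extends.formalMul _ _ hW (fun r => h (f r)) (extends_constSeries_one U W) m x hxW,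
      s.star_one, h (f m) x hxW]

theorem StarProduct.isRestriction_restrict (s : StarProduct P) (U : Opens M) :
    s.IsRestriction (s.restrict U) :=
  fun r f g => restrictBilinear_restrict
    (fun g => (s.isLocalOn_left r g).mono (Set.subset_univ _))
    (fun f => (s.isLocalOn_right r f).mono (Set.subset_univ _)) f g

theorem StarProduct.extends_formalMul (s : StarProduct P) {U : Opens M} {W : Set M}
    (hW : IsOpen W) {u v : ℕ → SmoothFun n U} {F G : ℕ → SmoothFun n M}
    (hu : ∀ r, Extends W (u r) (F r)) (hv : ∀ r, Extends W (v r) (G r)) (m : ℕ) :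
    Extends W (formalMul (s.restrict U).C u v m) (formalMul s.C F G m) :=
  Extends.formalMul (fun r g => (s.isLocalOn_left r g).mono (Set.subset_univ _))
    (fun r f => (s.isLocalOn_right r f).mono (Set.subset_univ _)) hW hu hv m

/-- A formal series of linear operators which is multiplicative on an open subset is there an
equivalence of star products. -/
theorem StarProduct.equivalent_restrict {s : StarProduct P} {s' : StarProduct P'} {U : Opens M}
    {T : ℕ → SmoothFun n M →ₗ[ℂ] SmoothFun n M} (hloc : ∀ r, IsLocalOn U (T r))
    (hT0 : ∀ f, ∀ x ∈ U, T 0 f x = f x)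
    (hT : ∀ a a', AgreeOn U (DeformationQuantization.formalApply T (formalMul s'.C a a'))
      (formalMul s.C (formalApply T a) (formalApply T a'))) :
    (s.restrict U).Equivalent (s'.restrict U) := by
  refine ⟨fun r => restrictLinear (T r) (hloc r), ?_, fun r => ?_, fun f g => ?_⟩
  · refine LinearMap.ext fun f => ContMDiffMap.ext fun x => ?_
    obtain ⟨W, hW, hxW, -, h⟩ := SmoothFun.extendGerm_spec (n := n) U x
    rw [extends_restrictLinear _ hW (h f) x hxW, hT0 _ x x.2, LinearMap.id_apply, h f x hxW]
  · refine isDifferentialOperator_restrictLinear _ fun p hp => ?_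
    obtain ⟨V, m, hV, hpV, -, h⟩ := exists_hasOrderLTOn_of_agreeOn U.2 hT0 hT hp (r + 1)
    exact ⟨V, m, hV, hpV, h r r.lt_succ_self⟩
  · funext m
    refine ContMDiffMap.ext fun x => ?_
    obtain ⟨W, hW, hxW, -, h⟩ := SmoothFun.extendGerm_spec (n := n) U x
    have hf (r : ℕ) := h (f r)
    have hg (r : ℕ) := h (g r)
    exact (Extends.formalApply hloc hW (s'.extends_formalMul hW hf hg) m x hxW).trans
      ((hT _ _ m x x.2).trans (s.extends_formalMul hW (Extends.formalApply hloc hW hf)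
        (Extends.formalApply hloc hW hg) m x hxW).symm)

end RestrictStructures

end DeformationQuantization

/-! ### The main theorem -/

theorem mainTheorem10 {n : ℕ} {M : Type*} [TopologicalSpace M]
    [ChartedSpace (EuclideanSpace ℝ (Fin n)) M] [IsManifold (𝓡 n) ∞ M]
    [T2Space M] [SecondCountableTopology M]
    {P P' : DeformationQuantization.PoissonStructure n M}
    (s : DeformationQuantization.StarProduct P) (s' : DeformationQuantization.StarProduct P')
    {E : Type*} [AddCommGroup E] [Module ℂ E] [Module (DeformationQuantization.SmoothFun n M) E]
    [IsScalarTower ℂ (DeformationQuantization.SmoothFun n M) E]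
    (B : DeformationQuantization.DeformedBimodule s' s E)
    (hB : B.IsEquivalenceBimodule ∨ B.IsStarEquivalenceBimodule) :
    s.LocallyEquivalent s' ∧ ∀ f g, P.bracket f g = P'.bracket f g := by
  refine ⟨fun p => ?_, fun f g => ContMDiffMap.ext fun p => ?_⟩
  -- Both claims are local: the series found near `p` gives the equivalence on its domain `W` and
  -- equality of the brackets at `p`.
  all_goals
    obtain ⟨T, b, W, hW, hpW, hT0, hT1, hT⟩ := B.exists_coefficient hB p
    have hmul := DeformationQuantization.agreeOn_formalApply_formalMul hW hT0 hT1 hT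
  · exact ⟨⟨W, hW⟩, hpW, P.restrict ⟨W, hW⟩, P'.restrict ⟨W, hW⟩, s.restrict ⟨W, hW⟩,
      s'.restrict ⟨W, hW⟩, s.isRestriction_restrict _, s'.isRestriction_restrict _,
      DeformationQuantization.StarProduct.equivalent_restrict
        (DeformationQuantization.isLocalOn_of_middle_mul hT0 hT) hT0 hmul⟩
  · exact DeformationQuantization.bracket_eq_of_agreeOn hT0 hW hmul f g p hpW
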